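/- Let $\nu_1,\nu_3,\nu_4\in\mathbb{C}$ with $\operatorname{Re}\nu_1>0$, and consider the $\sigma$-form of the sixth Painlevé equation (with $\nu_2=\nu_1$) $$u'\,[u''\,t(t-1)]^2+\left[2u'(tu'-u)-u'^2-\nu_1^2\nu_3\nu_4\right]^2=(u'+\nu_1^2)^2(u'+\nu_3^2)(u'+\nu_4^2).$$ Let $A<B$ be real numbers and, for $\rho>0$, let $\mathcal{S}_\rho=\{t:\ |t|>\rho,\ A<\arg t<B\}$, regarded as a subset of the Riemann surface of the logarithm above $\mathbb{C}\setminus\{0\}$ (if $B-A\le 2\pi$ this is a sector in the plane with a fixed branch of $\arg t$); on it $t^{a}=e^{a\log t}$ with $\log t=\ln|t|+i\arg t$. Then for every $C\in\mathbb{C}$ there are $\rho>0$ and a holomorphic solution $u$ of the equation on $\mathcal{S}_\rho$ with $$u(t)=-\nu_1^2t+\tfrac12(\nu_1^2+\nu_3\nu_4)+Ct^{-2\nu_1}+o(t^{-2\nu_1})\qquad(t\to\infty,\ A<\arg t<B),$$ the limit being uniform in $\arg t$. It is unique: if $v$ is a holomorphic solution on $\mathcal{S}_{\rho'}$ for some $\rho'>0$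 with the same expansion, with the same $C$, then $v=u$ on $\mathcal{S}_{\max(\rho,\rho')}$. Moreover, the remainder of this solution satisfies $$u(t)-\left(-\nu_1^2t+\tfrac12(\nu_1^2+\nu_3\nu_4)+Ct^{-2\nu_1}\right)=O(t^{-1-2\nu_1})\qquad(t\to\infty,\ A<\arg t<B).$$ -/

import Mathlib

open Filter Asymptotics Complex

namespace PainleveSixSigma

/-! Points of the Riemann surface of the logarithm above `ℂ \ {0}` are represented by
`ζ = log t ∈ ℂ`, that is `t = exp ζ`, `|t| = exp (re ζ)` and `arg t = im ζ`. The power `t ^ a` is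
then the single-valued function `exp (a * ζ)`. A subset of the plane on which a branch of `arg t`
has been fixed is the special case in which the values of `im ζ` fill an interval of length at
most `2 π`. -/

/-- The part `|t| > ρ` of the sector `A < arg t < B`. The opening `B - A` may exceed `2 π`. -/
noncomputable def sector (A B ρ : ℝ) : Set ℂ :=
  {ζ | A < ζ.im ∧ ζ.im < B ∧ ρ < ‖exp ζ‖}

/-- The filter `t → ∞` in the sector `A < arg t < B` (uniformly in `arg t`). -/
noncomputable def atInfty (A B : ℝ) : Filter ℂ :=
  comap (fun ζ : ℂ => ‖exp ζ‖) atTop ⊓ 𝓟 {ζ | A < ζ.im ∧ ζ.im < B}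

/-- The derivative `d/dt = exp (-ζ) d/dζ` with respect to `t = exp ζ`. -/
noncomputable def tDeriv (u : ℂ → ℂ) (ζ : ℂ) : ℂ :=
  exp (-ζ) * deriv u ζ

/-- For a function of `t` in the plane, `tDeriv` is the usual complex derivative. -/
theorem tDeriv_comp_exp {f : ℂ → ℂ} {ζ : ℂ} (hf : DifferentiableAt ℂ f (exp ζ)) :
    tDeriv (fun z => f (exp z)) ζ = deriv f (exp ζ) := by
  have h : HasDerivAt (fun z => f (exp z)) (deriv f (exp ζ) * exp ζ) ζ :=
    hf.hasDerivAt.comp ζ (hasDerivAt_exp ζ)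
  rw [tDeriv, h.deriv, mul_comm (deriv f (exp ζ)), ← mul_assoc, ← exp_add]
  simp

/-- The σ-form of the sixth Painlevé equation with `ν₂ = ν₁`, at the point `t = exp ζ`. -/
def SigmaPVI (ν₁ ν₃ ν₄ : ℂ) (u : ℂ → ℂ) (ζ : ℂ) : Prop :=
  let t : ℂ := exp ζ
  let u₀ : ℂ := u ζ
  let u₁ : ℂ := tDeriv u ζ
  let u₂ : ℂ := tDeriv (tDeriv u) ζ
  u₁ * (u₂ * t * (t - 1)) ^ 2 + (2 * u₁ * (t * u₁ - u₀) - u₁ ^ 2 - ν₁ ^ 2 * ν₃ * ν₄) ^ 2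
    = (u₁ + ν₁ ^ 2) ^ 2 * (u₁ + ν₃ ^ 2) * (u₁ + ν₄ ^ 2)

/-- `u` is a (holomorphic) solution in the part `|t| > ρ` of the sector `A < arg t < B`. -/
def IsSolution (ν₁ ν₃ ν₄ : ℂ) (A B ρ : ℝ) (u : ℂ → ℂ) : Prop :=
  DifferentiableOn ℂ u (sector A B ρ) ∧ ∀ ζ ∈ sector A B ρ, SigmaPVI ν₁ ν₃ ν₄ u ζ

/-- The remainder `u(t) - (-ν₁² t + (ν₁² + ν₃ ν₄) / 2 + C t ^ (-2 ν₁))`. -/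
noncomputable def remainder (ν₁ ν₃ ν₄ C : ℂ) (u : ℂ → ℂ) (ζ : ℂ) : ℂ :=
  u ζ - (-ν₁ ^ 2 * exp ζ + (1 / 2) * (ν₁ ^ 2 + ν₃ * ν₄) + C * exp (-2 * ν₁ * ζ))

/-- `u(t) = -ν₁² t + (ν₁² + ν₃ ν₄) / 2 + C t ^ (-2 ν₁) + o(t ^ (-2 ν₁))` as `t → ∞` in the
sector `A < arg t < B`. -/
def HasExpansion (ν₁ ν₃ ν₄ C : ℂ) (A B : ℝ) (u : ℂ → ℂ) : Prop :=
  remainder ν₁ ν₃ ν₄ C u =o[atInfty A B] fun ζ => exp (-2 * ν₁ * ζ)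

end PainleveSixSigma

/-! In the coordinate `ζ = log t`, put `a = ν₁`, `s = 1 / t = exp (-ζ)` and
`w = u - (-a² t + (a² + ν₃ ν₄) / 2)`. With `r = t w' - w` and `q = t² w''` the equation becomes
`sigmaPoly s w r q = 0`, and `dw/dζ = w + r`, `dr/dζ = q`. This second-order equation is quadratic
in `q`, which is inconvenient where the two branches meet (in particular for `C = 0`). Its
derivative, however, is `q` times an expression that is linear in `dq/dζ`
(`hasDerivAt_sigmaPoly`), which gives the third-order equation
`dq/dζ = 4 a² r + s M (s, w, r, q)` with `M` holomorphic near the origin and `M (s, 0) = 0`. For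
solutions that decay like `t ^ (-2 a)` the two equations are equivalent: the defect of the σ-form is
a first integral of the third-order equation, and tends to zero (`sigmaPoly_eq_zero`); conversely
the factor `q` can be cancelled, unless it vanishes identically and then `w = 0`
(`ForcedSystem.of_sigmaPoly`).

After rescaling by `t ^ (2 a)` the third-order equation is a linear system with exponents `1 + 2 a`,
`4 a` and `0` and a forcing term that carries the factor `s`. Since `re a > 0`, a bounded solution
is determined by the forcing and by the limit `C` of its first component: it is obtained by
integrating along rays to infinity (`forcedSol`, `ForcedSystem.eq_forcedSol`), and depends on the
forcing through a factor `s`. For `|t|` large the forcing is therefore the fixed point of a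
contraction of bounded holomorphic functions, which yields existence with a relative error
`O(1 / t)` (`exists_forcedSystem`) and uniqueness (`ForcedSystem.eqOn`). An arbitrary solution with
the given expansion has bounded rescaled derivatives in a smaller sector by Cauchy's estimates
(`exists_forcedSystem_of_solution`), so the uniqueness applies there, and the identity theorem
extends it to the whole sector (`eqOn_of_hasExpansion`). -/

namespace PainleveSixSigma

/-! ### Half-strips -/

/-- The half-strip `A < im ζ < B`, `R < re ζ`: the sector `|t| > exp R`, `A < arg t < B` in the
logarithmic coordinate. -/
def strip (A B R : ℝ) : Set ℂ :=
  {ζ | A < ζ.im ∧ ζ.im < B ∧ R < ζ.re}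

theorem sector_exp (A B R : ℝ) : sector A B (Real.exp R) = strip A B R := by
  ext ζ
  simp [sector, strip, norm_exp]

theorem isOpen_strip (A B R : ℝ) : IsOpen (strip A B R) :=
  (isOpen_lt continuous_const continuous_im).inter
    ((isOpen_lt continuous_im continuous_const).inter (isOpen_lt continuous_const continuous_re))

theorem isPreconnected_strip (A B R : ℝ) : IsPreconnected (strip A B R) := by
  have h : Convex ℝ (strip A B R) :=
    (convex_halfSpace_im_gt A).inter ((convex_halfSpace_im_lt B).inter (convex_halfSpace_re_gt R))
  exact h.isPreconnected

theorem strip_mono {A B R A' B' R' : ℝ} (hA : A ≤ A') (hB : B' ≤ B) (hR : R ≤ R') :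
    strip A' B' R' ⊆ strip A B R :=
  fun _ h => ⟨hA.trans_lt h.1, h.2.1.trans_le hB, hR.trans_lt h.2.2⟩

theorem add_ofReal_mem_strip {A B R : ℝ} {ζ : ℂ} (hζ : ζ ∈ strip A B R) {τ : ℝ} (hτ : 0 ≤ τ) :
    ζ + τ ∈ strip A B R := by
  obtain ⟨h1, h2, h3⟩ := hζ
  refine ⟨by simpa using h1, by simpa using h2, ?_⟩
  simp only [add_re, ofReal_re]
  linarith

theorem strip_nonempty {A B : ℝ} (hAB : A < B) (R : ℝ) : (strip A B R).Nonempty :=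
  ⟨⟨R + 1, (A + B) / 2⟩, by dsimp; linarith, by dsimp; linarith, by dsimp; linarith⟩

/-- Along a horizontal ray, that is, with `arg t` fixed, powers `t ^ c` with `re c < 0` tend to
zero. -/
theorem tendsto_exp_mul_ray {c : ℂ} (hc : c.re < 0) (ζ : ℂ) :
    Tendsto (fun τ : ℝ => exp (c * (ζ + τ))) atTop (nhds 0) := by
  rw [tendsto_exp_nhds_zero_iff]
  have : ∀ τ : ℝ, (c * (ζ + τ)).re = (c * ζ).re + c.re * τ := by intro τ; simp; ring
  simp_rw [this]
  exact tendsto_atBot_add_const_left _ _ (tendsto_id.const_mul_atTop_of_neg hc)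

theorem tendsto_exp_neg_ray (ζ : ℂ) :
    Tendsto (fun τ : ℝ => exp (-(ζ + τ))) atTop (nhds 0) := by
  simpa using tendsto_exp_mul_ray (c := -1) (by simp) ζ

/-- Powers `t ^ c` with `re c < 0` tend to zero uniformly in a sector. -/
theorem exists_norm_exp_mul_lt {c : ℂ} (hc : c.re < 0) (A B : ℝ) {η : ℝ} (hη : 0 < η) :
    ∃ R₀, ∀ R, R₀ ≤ R → ∀ ζ ∈ strip A B R, ‖exp (c * ζ)‖ < η := by
  refine ⟨(Real.log η - |c.im| * max |A| |B|) / c.re, fun R hR ζ hζ => ?_⟩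
  obtain ⟨h1, h2, h3⟩ := hζ
  rw [norm_exp, ← Real.lt_log_iff_exp_lt hη]
  have him : |ζ.im| ≤ max |A| |B| := abs_le_max_abs_abs h1.le h2.le
  have h4 : -(c.im * ζ.im) ≤ |c.im| * max |A| |B| :=
    (neg_le_abs _).trans (by rw [abs_mul]; gcongr)
  have h5 : (Real.log η - |c.im| * max |A| |B|) / c.re < ζ.re := hR.trans_lt h3
  rw [div_lt_iff_of_neg hc] at h5
  simp only [mul_re]
  linarith

/-! ### Cauchy estimates and the Laplace-type operator -/

/-- `f` is holomorphic on `Ω` and bounded by `F` there. -/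
structure HolBdd (Ω : Set ℂ) (F : ℝ) (f : ℂ → ℂ) : Prop where
  diff : DifferentiableOn ℂ f Ω
  bound : ∀ ζ ∈ Ω, ‖f ζ‖ ≤ F

theorem HolBdd.sub {Ω : Set ℂ} {F G : ℝ} {f g : ℂ → ℂ} (hf : HolBdd Ω F f) (hg : HolBdd Ω G g) :
    HolBdd Ω (F + G) (f - g) :=
  ⟨hf.diff.sub hg.diff, fun ζ hζ => (norm_sub_le _ _).trans
    (add_le_add (hf.bound ζ hζ) (hg.bound ζ hζ))⟩

theorem HolBdd.mono {Ω Ω' : Set ℂ} {F : ℝ} {f : ℂ → ℂ} (hf : HolBdd Ω F f) (h : Ω' ⊆ Ω) :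
    HolBdd Ω' F f :=
  ⟨hf.diff.mono h, fun ζ hζ => hf.bound ζ (h hζ)⟩

theorem closedBall_subset_strip {A B R ε : ℝ} {ζ : ℂ}
    (hζ : ζ ∈ strip (A + ε) (B - ε) (R + ε)) : Metric.closedBall ζ ε ⊆ strip A B R := by
  intro z hz
  rw [Metric.mem_closedBall, dist_eq_norm] at hz
  obtain ⟨h1, h2, h3⟩ := hζ
  have him := (abs_le.1 ((abs_im_le_norm (z - ζ)).trans hz))
  have hre := (abs_le.1 ((abs_re_le_norm (z - ζ)).trans hz))
  simp only [sub_im, sub_re] at him hre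
  exact ⟨by linarith, by linarith, by linarith⟩

theorem HolBdd.deriv {A B R F ε : ℝ} (hε : 0 < ε) {f : ℂ → ℂ} (hf : HolBdd (strip A B R) F f) :
    HolBdd (strip (A + ε) (B - ε) (R + ε)) (F / ε) (deriv f) := by
  refine ⟨(hf.diff.deriv (isOpen_strip _ _ _)).mono
    (strip_mono (by linarith) (by linarith) (by linarith)), fun ζ hζ => ?_⟩
  have hb := closedBall_subset_strip hζ
  refine Complex.norm_deriv_le_of_forall_mem_sphere_norm_le hε ?_
    fun z hz => hf.bound z (hb (Metric.sphere_subset_closedBall hz))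
  exact (hf.diff.mono hb).diffContOnCl_ball (U := Metric.closedBall ζ ε) subset_rfl

/-- The operator `J_λ f (ζ) = ∫₀^∞ exp (-λ τ) f (ζ + τ) dτ`, which for `re λ > 0` is the inverse
of `λ - d/dζ` on bounded holomorphic functions. -/
noncomputable def laplace (l : ℂ) (f : ℂ → ℂ) (ζ : ℂ) : ℂ :=
  ∫ τ in Set.Ioi (0 : ℝ), exp (-l * τ) * f (ζ + τ)

section Laplace

variable {A B R F : ℝ} {l : ℂ} {f g : ℂ → ℂ}

open MeasureTheory

theorem norm_exp_mul_comp_le (hf : ∀ ζ ∈ strip A B R, ‖f ζ‖ ≤ F) {ζ : ℂ} (hζ : ζ ∈ strip A B R)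
    {τ : ℝ} (hτ : 0 ≤ τ) : ‖exp (-l * τ) * f (ζ + τ)‖ ≤ Real.exp (-l.re * τ) * F := by
  rw [norm_mul, norm_exp]
  gcongr
  · simp
  · exact hf _ (add_ofReal_mem_strip hζ hτ)

theorem aestronglyMeasurable_laplace (hf : ContinuousOn f (strip A B R)) {ζ : ℂ}
    (hζ : ζ ∈ strip A B R) : AEStronglyMeasurable (fun τ : ℝ => exp (-l * τ) * f (ζ + τ))
      (volume.restrict (Set.Ioi 0)) := by
  refine ContinuousOn.aestronglyMeasurable ?_ measurableSet_Ioi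
  refine (Continuous.continuousOn (by fun_prop)).mul (hf.comp (by fun_prop) fun τ hτ => ?_)
  exact add_ofReal_mem_strip hζ (le_of_lt hτ)

theorem integrableOn_laplace_bound (hl : 0 < l.re) (F : ℝ) :
    IntegrableOn (fun τ : ℝ => Real.exp (-l.re * τ) * F) (Set.Ioi 0) :=
  (integrableOn_exp_mul_Ioi (neg_lt_zero.2 hl) 0).mul_const F

theorem integrableOn_laplace (hl : 0 < l.re) (hfc : ContinuousOn f (strip A B R))
    (hf : ∀ ζ ∈ strip A B R, ‖f ζ‖ ≤ F) {ζ : ℂ} (hζ : ζ ∈ strip A B R) :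
    IntegrableOn (fun τ : ℝ => exp (-l * τ) * f (ζ + τ)) (Set.Ioi 0) := by
  refine Integrable.mono' (integrableOn_laplace_bound hl F)
    (aestronglyMeasurable_laplace hfc hζ) ?_
  filter_upwards [ae_restrict_mem measurableSet_Ioi] with τ hτ
  exact norm_exp_mul_comp_le hf hζ (le_of_lt hτ)

theorem norm_laplace_le (hl : 0 < l.re) (hf : ∀ ζ ∈ strip A B R, ‖f ζ‖ ≤ F) {ζ : ℂ}
    (hζ : ζ ∈ strip A B R) : ‖laplace l f ζ‖ ≤ F / l.re := by
  have h := norm_integral_le_of_norm_le (integrableOn_laplace_bound hl F)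
    (f := fun τ : ℝ => exp (-l * τ) * f (ζ + τ)) (by
      filter_upwards [ae_restrict_mem measurableSet_Ioi] with τ hτ
      exact norm_exp_mul_comp_le hf hζ (le_of_lt hτ))
  refine h.trans_eq ?_
  rw [integral_mul_const, integral_exp_mul_Ioi (neg_lt_zero.2 hl)]
  simp
  ring

theorem laplace_sub (hl : 0 < l.re) {G : ℝ} (hf : HolBdd (strip A B R) F f)
    (hg : HolBdd (strip A B R) G g) {ζ : ℂ} (hζ : ζ ∈ strip A B R) :
    laplace l (f - g) ζ = laplace l f ζ - laplace l g ζ := by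
  rw [laplace, laplace, laplace, ← integral_sub
    (integrableOn_laplace hl hf.diff.continuousOn hf.bound hζ)
    (integrableOn_laplace hl hg.diff.continuousOn hg.bound hζ)]
  simp [mul_sub]

@[simp]
theorem laplace_zero (l ζ : ℂ) : laplace l 0 ζ = 0 := by simp [laplace]

theorem laplace_congr (h : Set.EqOn f g (strip A B R)) {ζ : ℂ} (hζ : ζ ∈ strip A B R) :
    laplace l f ζ = laplace l g ζ := by
  refine setIntegral_congr_fun measurableSet_Ioi fun τ hτ => ?_
  simp only [h (add_ofReal_mem_strip hζ (le_of_lt hτ))]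

/-- `(d/dζ - λ) J_λ f = -f`. The derivative is taken under the integral sign, with a Cauchy
estimate as dominating bound, and then removed from `f` by integrating `d/dτ`. -/
theorem hasDerivAt_laplace (hl : 0 < l.re) (hf : HolBdd (strip A B R) F f) {ζ : ℂ}
    (hζ : ζ ∈ strip A B R) : HasDerivAt (laplace l f) (l * laplace l f ζ - f ζ) ζ := by
  obtain ⟨ε, hε, hmem⟩ : ∃ ε > 0, ζ ∈ strip (A + ε) (B - ε) (R + ε) := by
    obtain ⟨h1, h2, h3⟩ := hζ
    refine ⟨min (ζ.im - A) (min (B - ζ.im) (ζ.re - R)) / 2, ?_, ?_⟩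
    · have : 0 < min (ζ.im - A) (min (B - ζ.im) (ζ.re - R)) := by simp [*]
      linarith
    · have h4 : 0 < min (ζ.im - A) (min (B - ζ.im) (ζ.re - R)) := by simp [*]
      have a1 := min_le_left (ζ.im - A) (min (B - ζ.im) (ζ.re - R))
      have a2 := min_le_right (ζ.im - A) (min (B - ζ.im) (ζ.re - R))
      have a3 := min_le_left (B - ζ.im) (ζ.re - R)
      have a4 := min_le_right (B - ζ.im) (ζ.re - R)
      exact ⟨by linarith, by linarith, by linarith⟩
  have hd := hf.deriv hε
  have hsub : strip (A + ε) (B - ε) (R + ε) ⊆ strip A B R :=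
    strip_mono (by linarith) (by linarith) (by linarith)
  have hfd : ∀ z ∈ strip A B R, HasDerivAt f (deriv f z) z := fun z hz =>
    (hf.diff.differentiableAt ((isOpen_strip _ _ _).mem_nhds hz)).hasDerivAt
  have hopen := (isOpen_strip (A + ε) (B - ε) (R + ε)).mem_nhds hmem
  obtain ⟨hint, hder⟩ := hasDerivAt_integral_of_dominated_loc_of_deriv_le
    (μ := volume.restrict (Set.Ioi (0 : ℝ))) (𝕜 := ℂ)
    (F := fun z (τ : ℝ) => exp (-l * τ) * f (z + τ))
    (F' := fun z (τ : ℝ) => exp (-l * τ) * deriv f (z + τ))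
    (bound := fun τ => Real.exp (-l.re * τ) * (F / ε)) (x₀ := ζ) hopen
    (by
      filter_upwards [hopen] with z hz
      exact aestronglyMeasurable_laplace hf.diff.continuousOn (hsub hz))
    (integrableOn_laplace hl hf.diff.continuousOn hf.bound hζ)
    (aestronglyMeasurable_laplace hd.diff.continuousOn hmem)
    (by
      filter_upwards [ae_restrict_mem measurableSet_Ioi] with τ hτ z hz
      exact norm_exp_mul_comp_le hd.bound hz (le_of_lt hτ))
    (integrableOn_laplace_bound hl _)
    (by
      filter_upwards [ae_restrict_mem measurableSet_Ioi] with τ hτ z hz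
      have h := hfd (z + τ) (hsub (add_ofReal_mem_strip hz (le_of_lt hτ)))
      exact (h.comp_add_const z (τ : ℂ)).const_mul _)
  have hI := integrableOn_laplace hl hf.diff.continuousOn hf.bound hζ
  have hftc := integral_Ioi_of_hasDerivAt_of_tendsto' (a := (0 : ℝ)) (m := 0)
    (f := fun τ : ℝ => exp (-l * τ) * f (ζ + τ))
    (f' := fun τ : ℝ => exp (-l * τ) * deriv f (ζ + τ) - l * (exp (-l * τ) * f (ζ + τ)))
    (by
      intro τ hτ
      have h1 : HasDerivAt (fun τ : ℝ => f (ζ + τ)) (deriv f (ζ + τ)) τ := by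
        have h := (hfd _ (add_ofReal_mem_strip hζ hτ)).comp_const_add ζ (τ : ℂ)
        exact h.comp_ofReal
      have h2 : HasDerivAt (fun τ : ℝ => exp (-l * τ)) (exp (-l * τ) * (-l * 1)) τ :=
        (((hasDerivAt_id (τ : ℂ)).const_mul (-l)).cexp).comp_ofReal
      convert! h2.mul h1 using 1
      ring)
    (hint.sub (hI.const_mul l))
    (by
      rw [tendsto_zero_iff_norm_tendsto_zero]
      have h0 : Tendsto (fun τ : ℝ => Real.exp (-l.re * τ) * F) atTop (nhds (0 * F)) := by
        refine Tendsto.mul_const F (Real.tendsto_exp_atBot.comp ?_)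
        exact tendsto_id.const_mul_atTop_of_neg (neg_lt_zero.2 hl)
      rw [zero_mul] at h0
      refine squeeze_zero' (Eventually.of_forall fun _ => norm_nonneg _) ?_ h0
      filter_upwards [eventually_ge_atTop 0] with τ hτ
      exact norm_exp_mul_comp_le hf.bound hζ hτ)
  rw [integral_sub hint (hI.const_mul l), integral_const_mul] at hftc
  convert! hder using 1
  simp only [ofReal_zero, mul_zero, exp_zero, one_mul, add_zero, zero_sub] at hftc
  rw [laplace]
  linear_combination -hftc

end Laplace

/-! ### Bounded solutions of linear equations, and holomorphic fixed points -/

/-- A growing exponential is the only solution of `h' = λ h`, `re λ > 0`, so a bounded one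
vanishes. -/
theorem eq_zero_of_hasDerivAt_mul {A B R F : ℝ} {l : ℂ} (hl : 0 < l.re) {h : ℂ → ℂ}
    (hd : ∀ ζ ∈ strip A B R, HasDerivAt h (l * h ζ) ζ) (hb : ∀ ζ ∈ strip A B R, ‖h ζ‖ ≤ F)
    {ζ : ℂ} (hζ : ζ ∈ strip A B R) : h ζ = 0 := by
  have hk : ∀ z ∈ strip A B R, HasDerivAt (fun z => exp (-l * z) * h z) 0 z := by
    intro z hz
    convert! (((hasDerivAt_id z).const_mul (-l)).cexp).mul (hd z hz) using 1
    simp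
    ring
  have hconst : ∀ τ : ℝ, 0 ≤ τ → exp (-l * (ζ + τ)) * h (ζ + τ) = exp (-l * ζ) * h ζ :=
    fun τ hτ => (isOpen_strip A B R).is_const_of_deriv_eq_zero (isPreconnected_strip A B R)
      (fun z hz => (hk z hz).differentiableAt.differentiableWithinAt)
      (fun z hz => (hk z hz).deriv) (add_ofReal_mem_strip hζ hτ) hζ
  have hlim : Tendsto (fun τ : ℝ => exp (-l * (ζ + τ)) * h (ζ + τ)) atTop (nhds 0) := by
    refine (tendsto_exp_mul_ray (by simpa using hl) ζ).zero_mul_isBoundedUnder_le ?_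
    refine ⟨F, ?_⟩
    rw [eventually_map]
    filter_upwards [eventually_ge_atTop 0] with τ hτ
    exact hb _ (add_ofReal_mem_strip hζ hτ)
  have hlim' : Tendsto (fun τ : ℝ => exp (-l * (ζ + τ)) * h (ζ + τ)) atTop
      (nhds (exp (-l * ζ) * h ζ)) :=
    tendsto_const_nhds.congr' (by
      filter_upwards [eventually_ge_atTop 0] with τ hτ
      exact (hconst τ hτ).symm)
  have := tendsto_nhds_unique hlim' hlim
  simpa [exp_ne_zero] using this

theorem eq_const_of_hasDerivAt_zero {A B R : ℝ} {h : ℂ → ℂ}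
    (hd : ∀ ζ ∈ strip A B R, HasDerivAt h 0 ζ) : ∃ k, ∀ ζ ∈ strip A B R, h ζ = k :=
  (isOpen_strip A B R).exists_is_const_of_deriv_eq_zero (isPreconnected_strip A B R)
    (fun z hz => (hd z hz).differentiableAt.differentiableWithinAt) (fun z hz => (hd z hz).deriv)

/-- The contraction principle in the ball of radius `F` of the bounded holomorphic functions on an
open set. -/
theorem exists_holomorphic_fixedPoint {Ω : Set ℂ} (hΩ : IsOpen Ω) {F : ℝ} (hF : 0 ≤ F)
    (Φ : (ℂ → ℂ) → ℂ → ℂ) (hΦ : ∀ f, HolBdd Ω F f → HolBdd Ω F (Φ f))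
    (hc : ∀ f g, HolBdd Ω F f → HolBdd Ω F g → ∀ d : ℝ, (∀ ζ ∈ Ω, ‖f ζ - g ζ‖ ≤ d) →
      ∀ ζ ∈ Ω, ‖Φ f ζ - Φ g ζ‖ ≤ d / 2) :
    ∃ f, HolBdd Ω F f ∧ ∀ ζ ∈ Ω, Φ f ζ = f ζ := by
  set φ : ℕ → ℂ → ℂ := fun n => Φ^[n] 0 with hφ
  have hφs : ∀ n, φ (n + 1) = Φ (φ n) := fun n => Function.iterate_succ_apply' Φ n 0
  have hφb : ∀ n, HolBdd Ω F (φ n) := by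
    intro n
    induction n with
    | zero => exact ⟨differentiableOn_const 0, fun ζ _ => by simpa [hφ] using hF⟩
    | succ n ih => rw [hφs]; exact hΦ _ ih
  have hstep : ∀ n, ∀ ζ ∈ Ω, ‖φ (n + 1) ζ - φ n ζ‖ ≤ F * (1 / 2) ^ n := by
    intro n
    induction n with
    | zero =>
      intro ζ hζ
      simpa [hφ] using (hφb 1).bound ζ hζ
    | succ n ih =>
      intro ζ hζ
      have h := hc _ _ (hφb (n + 1)) (hφb n) _ ih ζ hζ
      rw [← hφs, ← hφs] at h
      refine h.trans_eq ?_
      ring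
  have hgeom : Summable fun n : ℕ => F * (1 / 2 : ℝ) ^ n :=
    (summable_geometric_of_lt_one (by norm_num) (by norm_num)).mul_left F
  set f : ℂ → ℂ := fun ζ => ∑' n, (φ (n + 1) ζ - φ n ζ) with hf
  have hfd : DifferentiableOn ℂ f Ω :=
    differentiableOn_tsum_of_summable_norm hgeom
      (fun n => (hφb (n + 1)).diff.sub (hφb n).diff) hΩ fun n ζ hζ => hstep n ζ hζ
  have hpart : ∀ n ζ, ∑ i ∈ Finset.range n, (φ (i + 1) ζ - φ i ζ) = φ n ζ := by
    intro n ζ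
    rw [Finset.sum_range_sub (fun i => φ i ζ)]
    simp [hφ]
  have hlim : ∀ ζ ∈ Ω, Tendsto (fun n => φ n ζ) atTop (nhds (f ζ)) := by
    intro ζ hζ
    have hs : Summable fun n => φ (n + 1) ζ - φ n ζ :=
      Summable.of_norm_bounded hgeom fun n => hstep n ζ hζ
    simpa only [hpart] using hs.hasSum.tendsto_sum_nat
  have hfb : HolBdd Ω F f :=
    ⟨hfd, fun ζ hζ => le_of_tendsto (hlim ζ hζ).norm
      (Eventually.of_forall fun n => (hφb n).bound ζ hζ)⟩
  have htail : ∀ n, ∀ ζ ∈ Ω, ‖f ζ - φ n ζ‖ ≤ F * 2 * (1 / 2) ^ n := by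
    intro n ζ hζ
    have h := dist_le_of_le_geometric_of_tendsto (1 / 2 : ℝ) F (by norm_num)
      (f := fun n => φ n ζ) (fun m => by
        rw [dist_comm, dist_eq_norm]; exact hstep m ζ hζ) (hlim ζ hζ) n
    rw [dist_comm, dist_eq_norm] at h
    refine h.trans_eq ?_
    norm_num
    ring
  refine ⟨f, hfb, fun ζ hζ => ?_⟩
  have h1 : Tendsto (fun n => φ (n + 1) ζ) atTop (nhds (Φ f ζ)) := by
    rw [tendsto_iff_norm_sub_tendsto_zero]
    have h0 : Tendsto (fun n : ℕ => F * 2 * (1 / 2 : ℝ) ^ n / 2) atTop (nhds 0) := by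
      have := ((tendsto_pow_atTop_nhds_zero_of_lt_one (r := (1 / 2 : ℝ)) (by norm_num)
        (by norm_num)).const_mul (F * 2)).div_const 2
      simpa using this
    refine squeeze_zero (fun _ => norm_nonneg _) (fun n => ?_) h0
    rw [hφs, norm_sub_rev]
    exact hc _ _ hfb (hφb n) _ (htail n) ζ hζ
  exact tendsto_nhds_unique h1 ((hlim ζ hζ).comp (tendsto_add_atTop_nat 1))

/-! ### The rescaled system and its integral form -/

/-- A nonlinearity `M (s, Z)` which near the origin is holomorphic and Lipschitz in `Z`, and which
vanishes for `Z = 0`. -/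
structure Tame (M : ℂ × ℂ × ℂ × ℂ → ℂ) (L ε : ℝ) : Prop where
  pos : 0 < ε
  nonneg : 0 ≤ L
  diff : DifferentiableOn ℂ M (Metric.ball 0 ε)
  lip : ∀ s Z Z', ‖s‖ < ε → ‖Z‖ < ε → ‖Z'‖ < ε → ‖M (s, Z) - M (s, Z')‖ ≤ L * ‖Z - Z'‖
  zero : ∀ s, M (s, 0) = 0

/-- The nonlinearity in terms of the rescaled unknown `Z`, where `exp (-2 a ζ) • Z` is the
original one. -/
noncomputable def forcing (a : ℂ) (M : ℂ × ℂ × ℂ × ℂ → ℂ) (Z : ℂ → ℂ × ℂ × ℂ) (ζ : ℂ) : ℂ :=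
  exp (2 * a * ζ) * M (exp (-ζ), exp (-2 * a * ζ) • Z ζ)

/-- The linear system `W' = (1 + 2 a) W + R`, `R' = 2 a R + Q`, `Q' = 2 a Q + 4 a² R + exp (-ζ) f` for
`Z = (W, R, Q)`. -/
structure ForcedSystem (a : ℂ) (f : ℂ → ℂ) (Ω : Set ℂ) (Z : ℂ → ℂ × ℂ × ℂ) : Prop where
  fst : ∀ ζ ∈ Ω, HasDerivAt (fun z => (Z z).1) ((1 + 2 * a) * (Z ζ).1 + (Z ζ).2.1) ζ
  snd : ∀ ζ ∈ Ω, HasDerivAt (fun z => (Z z).2.1) (2 * a * (Z ζ).2.1 + (Z ζ).2.2) ζ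
  thd : ∀ ζ ∈ Ω, HasDerivAt (fun z => (Z z).2.2)
    (2 * a * (Z ζ).2.2 + 4 * a ^ 2 * (Z ζ).2.1 + exp (-ζ) * f ζ) ζ

/-- The bounded solution of the forced system with `W → C`. -/
noncomputable def forcedSol (a C : ℂ) (f : ℂ → ℂ) (ζ : ℂ) : ℂ × ℂ × ℂ :=
  (C + exp (-ζ) / (4 * a) * laplace (2 + 2 * a) (laplace (4 * a + 1) f - laplace 1 f) ζ,
    -(1 + 2 * a) * C + exp (-ζ) / (4 * a) * (laplace 1 f ζ - laplace (4 * a + 1) f ζ),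
    2 * a * (1 + 2 * a) * C - exp (-ζ) / 2 * (laplace (4 * a + 1) f ζ + laplace 1 f ζ))

section

variable {A B R F G L ε : ℝ} {a C : ℂ} {f g : ℂ → ℂ} {M : ℂ × ℂ × ℂ × ℂ → ℂ}

theorem HolBdd.laplace {l : ℂ} (hl : 0 < l.re) (hf : HolBdd (strip A B R) F f) :
    HolBdd (strip A B R) (F / l.re) (laplace l f) :=
  ⟨fun _ hζ => (hasDerivAt_laplace hl hf hζ).differentiableAt.differentiableWithinAt,
    fun _ hζ => norm_laplace_le hl hf.bound hζ⟩

theorem forcedSystem_forcedSol (ha : 0 < a.re) (hf : HolBdd (strip A B R) F f) :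
    ForcedSystem a f (strip A B R) (forcedSol a C f) := by
  have ha0 : a ≠ 0 := fun h => by simp [h] at ha
  have h4 : 0 < (4 * a + 1).re := by simp; linarith
  have h2 : 0 < (2 + 2 * a).re := by simp; linarith
  have h1 : 0 < (1 : ℂ).re := by simp
  have hs : ∀ ζ : ℂ, HasDerivAt (fun z : ℂ => exp (-z)) (-exp (-ζ)) ζ := fun ζ => by
    simpa using (hasDerivAt_neg ζ).cexp
  have d4 := fun ζ (hζ : ζ ∈ strip A B R) => hasDerivAt_laplace h4 hf hζ
  have d1 := fun ζ (hζ : ζ ∈ strip A B R) => hasDerivAt_laplace h1 hf hζ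
  have d2 := fun ζ (hζ : ζ ∈ strip A B R) =>
    hasDerivAt_laplace h2 ((hf.laplace h4).sub (hf.laplace h1)) hζ
  refine ⟨fun ζ hζ => ?_, fun ζ hζ => ?_, fun ζ hζ => ?_⟩
  · convert! (((hs ζ).div_const (4 * a)).mul (d2 ζ hζ)).const_add C using 1
    simp only [forcedSol, Pi.sub_apply]
    field_simp
    ring
  · convert! (((hs ζ).div_const (4 * a)).mul ((d1 ζ hζ).sub (d4 ζ hζ))).const_add
      (-(1 + 2 * a) * C) using 1
    simp only [forcedSol, Pi.sub_apply]
    field_simp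
    ring
  · convert! (((hs ζ).div_const 2).mul ((d4 ζ hζ).add (d1 ζ hζ))).const_sub
      (2 * a * (1 + 2 * a) * C) using 1
    simp only [forcedSol, Pi.add_apply]
    field_simp
    ring

theorem forcedSol_sub_norm_le (ha : 0 < a.re) (hf : HolBdd (strip A B R) F f)
    (hg : HolBdd (strip A B R) G g) {d : ℝ} (hd : ∀ ζ ∈ strip A B R, ‖f ζ - g ζ‖ ≤ d) {ζ : ℂ}
    (hζ : ζ ∈ strip A B R) :
    ‖forcedSol a C f ζ - forcedSol a C g ζ‖ ≤ (2 * ‖1 / (4 * a)‖ + 1) * d * ‖exp (-ζ)‖ := by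
  have h4 : 0 < (4 * a + 1).re := by simp; linarith
  have h2 : 0 < (2 + 2 * a).re := by simp; linarith
  have h1 : 0 < (1 : ℂ).re := by simp
  have hd0 : 0 ≤ d := (norm_nonneg _).trans (hd ζ hζ)
  have key : ∀ {l : ℂ} {h : ℂ → ℂ} {D : ℝ}, 1 ≤ l.re → (∀ z ∈ strip A B R, ‖h z‖ ≤ D) →
      ∀ z ∈ strip A B R, ‖laplace l h z‖ ≤ D := fun hl hh z hz =>
    (norm_laplace_le (zero_lt_one.trans_le hl) hh hz).trans
      (div_le_self ((norm_nonneg _).trans (hh z hz)) hl)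
  have e4 : ∀ z ∈ strip A B R, ‖laplace (4 * a + 1) (f - g) z‖ ≤ d :=
    key (by simp; linarith) hd
  have e1 : ∀ z ∈ strip A B R, ‖laplace 1 (f - g) z‖ ≤ d := key (by simp) hd
  have e2 := key (l := 2 + 2 * a) (h := laplace (4 * a + 1) (f - g) - laplace 1 (f - g))
    (D := d + d) (by simp; linarith)
    (fun z hz => (norm_sub_le _ _).trans (add_le_add (e4 z hz) (e1 z hz))) ζ hζ
  have l4 := fun z (hz : z ∈ strip A B R) => laplace_sub h4 hf hg hz
  have l1 := fun z (hz : z ∈ strip A B R) => laplace_sub h1 hf hg hz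
  have l2 : laplace (2 + 2 * a) (laplace (4 * a + 1) (f - g) - laplace 1 (f - g)) ζ =
      laplace (2 + 2 * a) (laplace (4 * a + 1) f - laplace 1 f) ζ -
        laplace (2 + 2 * a) (laplace (4 * a + 1) g - laplace 1 g) ζ := by
    rw [← laplace_sub h2 ((hf.laplace h4).sub (hf.laplace h1))
      ((hg.laplace h4).sub (hg.laplace h1)) hζ]
    refine laplace_congr (fun z hz => ?_) hζ
    simp only [Pi.sub_apply, l4 z hz, l1 z hz]
    ring
  have n4 := e4 ζ hζ
  have n1 := e1 ζ hζ
  have hc : 0 ≤ ‖1 / (4 * a)‖ := norm_nonneg _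
  have hs : 0 ≤ ‖exp (-ζ)‖ := norm_nonneg _
  have hcs : 0 ≤ d * ‖exp (-ζ)‖ := by positivity
  have hccs : 0 ≤ ‖1 / (4 * a)‖ * (d * ‖exp (-ζ)‖) := by positivity
  rw [Prod.norm_def, Prod.norm_def]
  refine max_le ?_ (max_le ?_ ?_)
  · have : (forcedSol a C f ζ - forcedSol a C g ζ).1 = exp (-ζ) * (1 / (4 * a)) *
        laplace (2 + 2 * a) (laplace (4 * a + 1) (f - g) - laplace 1 (f - g)) ζ := by
      rw [l2]; simp only [forcedSol, Prod.fst_sub]; ring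
    rw [this, norm_mul, norm_mul]
    calc _ ≤ ‖exp (-ζ)‖ * ‖1 / (4 * a)‖ * (d + d) := by gcongr
      _ ≤ _ := by nlinarith
  · have : (forcedSol a C f ζ - forcedSol a C g ζ).2.1 = exp (-ζ) * (1 / (4 * a)) *
        (laplace 1 (f - g) ζ - laplace (4 * a + 1) (f - g) ζ) := by
      rw [l1 ζ hζ, l4 ζ hζ]; simp only [forcedSol, Prod.fst_sub, Prod.snd_sub]; ring
    rw [this, norm_mul, norm_mul]
    calc _ ≤ ‖exp (-ζ)‖ * ‖1 / (4 * a)‖ * (d + d) := by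
          gcongr
          exact (norm_sub_le _ _).trans (add_le_add n1 n4)
      _ ≤ _ := by nlinarith
  · have : (forcedSol a C f ζ - forcedSol a C g ζ).2.2 = -(exp (-ζ) * (1 / 2) *
        (laplace (4 * a + 1) (f - g) ζ + laplace 1 (f - g) ζ)) := by
      rw [l1 ζ hζ, l4 ζ hζ]; simp only [forcedSol, Prod.snd_sub]; ring
    rw [this, norm_neg, norm_mul, norm_mul]
    calc _ ≤ ‖exp (-ζ)‖ * ‖(1 / 2 : ℂ)‖ * (d + d) := by
          gcongr
          exact (norm_add_le _ _).trans (add_le_add n4 n1)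
      _ ≤ _ := by
          have : ‖(1 / 2 : ℂ)‖ = 1 / 2 := by norm_num
          rw [this]
          nlinarith

theorem forcedSol_zero (ζ : ℂ) :
    forcedSol a C 0 ζ = (C, -(1 + 2 * a) * C, 2 * a * (1 + 2 * a) * C) := by
  have h0 : ∀ l : ℂ, laplace l 0 = 0 := fun l => funext fun z => laplace_zero l z
  simp [forcedSol, h0]

/-- Bounded solutions tend to their leading term, with relative error `O(1 / t)`. -/
theorem norm_forcedSol_sub_le (ha : 0 < a.re) (hf : HolBdd (strip A B R) F f) {ζ : ℂ}
    (hζ : ζ ∈ strip A B R) :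
    ‖forcedSol a C f ζ - (C, -(1 + 2 * a) * C, 2 * a * (1 + 2 * a) * C)‖
      ≤ (2 * ‖1 / (4 * a)‖ + 1) * F * ‖exp (-ζ)‖ := by
  have h := forcedSol_sub_norm_le (C := C) (g := 0) (G := 0) (d := F) ha hf
    ⟨differentiableOn_const 0, fun _ _ => by simp⟩ (fun z hz => by simpa using hf.bound z hz) hζ
  rwa [forcedSol_zero] at h

/-- The exponents of the homogeneous system are `1 + 2 a`, `4 a` and `0`. A bounded solution has
no component along the first two, and the limit of `W` excludes the third. -/
theorem ForcedSystem.eq_forcedSol (ha : 0 < a.re) (hf : HolBdd (strip A B R) F f) {K : ℝ}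
    {Z : ℂ → ℂ × ℂ × ℂ} (hZ : ForcedSystem a f (strip A B R) Z)
    (hK : ∀ ζ ∈ strip A B R, ‖Z ζ‖ ≤ K)
    (hC : ∀ ζ ∈ strip A B R, Tendsto (fun τ : ℝ => (Z (ζ + τ)).1) atTop (nhds C)) :
    ∀ ζ ∈ strip A B R, Z ζ = forcedSol a C f ζ := by
  have ha0 : a ≠ 0 := fun h => by simp [h] at ha
  have ha2 : 1 + 2 * a ≠ 0 := fun h => by
    have := congrArg Complex.re h
    simp at this; linarith
  set Y := forcedSol a C f with hY
  have hYs : ForcedSystem a f (strip A B R) Y := forcedSystem_forcedSol ha hf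
  set κ : ℝ := (2 * ‖1 / (4 * a)‖ + 1) * F with hκ
  set Y0 : ℂ × ℂ × ℂ := (C, -(1 + 2 * a) * C, 2 * a * (1 + 2 * a) * C) with hY0
  have hYb : ∀ ζ ∈ strip A B R, ‖Y ζ‖ ≤ ‖Y0‖ + |κ| * Real.exp (-R) := by
    intro ζ hζ
    have h := norm_forcedSol_sub_le (C := C) ha hf hζ
    have hs : ‖exp (-ζ)‖ ≤ Real.exp (-R) := by
      rw [norm_exp]; simpa using hζ.2.2.le
    calc ‖Y ζ‖ = ‖Y0 + (Y ζ - Y0)‖ := by rw [add_sub_cancel]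
      _ ≤ ‖Y0‖ + ‖Y ζ - Y0‖ := norm_add_le _ _
      _ ≤ ‖Y0‖ + |κ| * Real.exp (-R) := by
        gcongr
        refine h.trans ?_
        gcongr
        exact le_abs_self _
  have hYC : ∀ ζ ∈ strip A B R, Tendsto (fun τ : ℝ => (Y (ζ + τ)).1) atTop (nhds C) := by
    intro ζ hζ
    rw [tendsto_iff_norm_sub_tendsto_zero]
    have h0 : Tendsto (fun τ : ℝ => κ * ‖exp (-(ζ + τ))‖) atTop (nhds 0) := by
      simpa using (tendsto_exp_neg_ray ζ).norm.const_mul κ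
    refine squeeze_zero' (Eventually.of_forall fun _ => norm_nonneg _) ?_ h0
    filter_upwards [eventually_ge_atTop 0] with τ hτ
    exact (norm_fst_le (Y (ζ + τ) - Y0)).trans
      (norm_forcedSol_sub_le ha hf (add_ofReal_mem_strip hζ hτ))
  set K' := K + (‖Y0‖ + |κ| * Real.exp (-R)) with hK'
  set D : ℂ → ℂ × ℂ × ℂ := fun ζ => Z ζ - Y ζ with hD
  have hDb : ∀ ζ ∈ strip A B R, ‖D ζ‖ ≤ K' := fun ζ hζ =>
    (norm_sub_le _ _).trans (add_le_add (hK ζ hζ) (hYb ζ hζ))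
  have d1 : ∀ ζ ∈ strip A B R,
      HasDerivAt (fun z => (D z).1) ((1 + 2 * a) * (D ζ).1 + (D ζ).2.1) ζ := fun ζ hζ => by
    convert! (hZ.fst ζ hζ).sub (hYs.fst ζ hζ) using 1
    simp [hD]; ring
  have d2 : ∀ ζ ∈ strip A B R,
      HasDerivAt (fun z => (D z).2.1) (2 * a * (D ζ).2.1 + (D ζ).2.2) ζ := fun ζ hζ => by
    convert! (hZ.snd ζ hζ).sub (hYs.snd ζ hζ) using 1
    simp [hD]; ring
  have d3 : ∀ ζ ∈ strip A B R,
      HasDerivAt (fun z => (D z).2.2) (2 * a * (D ζ).2.2 + 4 * a ^ 2 * (D ζ).2.1) ζ :=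
    fun ζ hζ => by
    convert! (hZ.thd ζ hζ).sub (hYs.thd ζ hζ) using 1
    simp [hD]; ring
  have b1 : ∀ ζ ∈ strip A B R, ‖(D ζ).1‖ ≤ K' := fun ζ hζ => (norm_fst_le _).trans (hDb ζ hζ)
  have b2 : ∀ ζ ∈ strip A B R, ‖(D ζ).2.1‖ ≤ K' := fun ζ hζ =>
    (norm_fst_le _).trans ((norm_snd_le _).trans (hDb ζ hζ))
  have b3 : ∀ ζ ∈ strip A B R, ‖(D ζ).2.2‖ ≤ K' := fun ζ hζ =>
    (norm_snd_le _).trans ((norm_snd_le _).trans (hDb ζ hζ))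
  -- The combination `Q + 2 a R` is the eigencomponent with exponent `4 a`.
  have hX : ∀ ζ ∈ strip A B R, (D ζ).2.2 + 2 * a * (D ζ).2.1 = 0 := fun ζ hζ =>
    eq_zero_of_hasDerivAt_mul (l := 4 * a) (F := K' + ‖2 * a‖ * K')
      (h := fun z => (D z).2.2 + 2 * a * (D z).2.1) (by simpa using ha)
      (fun z hz => by
        convert! (d3 z hz).add ((d2 z hz).const_mul (2 * a)) using 1
        ring)
      (fun z hz => (norm_add_le _ _).trans (add_le_add (b3 z hz) (by
        rw [norm_mul]; gcongr; exact b2 z hz))) hζ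
  obtain ⟨k, hk⟩ := eq_const_of_hasDerivAt_zero (A := A) (B := B) (R := R)
    (h := fun z => (D z).2.1) (fun z hz => by
      convert! d2 z hz using 1
      linear_combination -hX z hz)
  have hV : ∀ ζ ∈ strip A B R, (D ζ).1 + k / (1 + 2 * a) = 0 := fun ζ hζ =>
    eq_zero_of_hasDerivAt_mul (l := 1 + 2 * a) (F := K' + ‖k / (1 + 2 * a)‖)
      (h := fun z => (D z).1 + k / (1 + 2 * a)) (by simp; linarith)
      (fun z hz => by
        convert! (d1 z hz).add_const (k / (1 + 2 * a)) using 1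
        rw [← hk z hz]
        field_simp)
      (fun z hz => (norm_add_le _ _).trans (by gcongr; exact b1 z hz)) hζ
  intro ζ hζ
  have hDlim : Tendsto (fun τ : ℝ => (D (ζ + τ)).1) atTop (nhds 0) := by
    simpa [hD] using (hC ζ hζ).sub (hYC ζ hζ)
  have hDk : Tendsto (fun τ : ℝ => (D (ζ + τ)).1) atTop (nhds (-(k / (1 + 2 * a)))) := by
    refine tendsto_const_nhds.congr' ?_
    filter_upwards [eventually_ge_atTop 0] with τ hτ
    linear_combination -hV _ (add_ofReal_mem_strip hζ hτ)
  have hk0 : k / (1 + 2 * a) = 0 := by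
    have := tendsto_nhds_unique hDk hDlim
    simpa using this
  have hkz : k = 0 := by simpa [ha2] using hk0
  have z1 : (D ζ).1 = 0 := by simpa [hk0] using hV ζ hζ
  have z2 : (D ζ).2.1 = 0 := by rw [← hkz]; exact hk ζ hζ
  have z3 : (D ζ).2.2 = 0 := by simpa [z2] using hX ζ hζ
  have : D ζ = 0 := Prod.ext z1 (Prod.ext z2 z3)
  exact sub_eq_zero.1 this

/-! ### The contraction -/

theorem forcing_sub_norm_le (hM : Tame M L ε) {Z Z' : ℂ → ℂ × ℂ × ℂ} {ζ : ℂ} {K : ℝ}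
    (hs : ‖exp (-ζ)‖ < ε) (hK : ‖exp (-2 * a * ζ)‖ * K < ε) (hZ : ‖Z ζ‖ ≤ K)
    (hZ' : ‖Z' ζ‖ ≤ K) : ‖forcing a M Z ζ - forcing a M Z' ζ‖ ≤ L * ‖Z ζ - Z' ζ‖ := by
  have hsm : ∀ X : ℂ × ℂ × ℂ, ‖X‖ ≤ K → ‖exp (-2 * a * ζ) • X‖ < ε := fun X hX => by
    rw [norm_smul]
    exact (mul_le_mul_of_nonneg_left hX (norm_nonneg _)).trans_lt hK
  have h := hM.lip (exp (-ζ)) _ _ hs (hsm _ hZ) (hsm _ hZ')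
  rw [← smul_sub, norm_smul] at h
  have he : ‖exp (2 * a * ζ)‖ * ‖exp (-2 * a * ζ)‖ = 1 := by
    rw [← norm_mul, ← exp_add]
    simp
  rw [forcing, forcing, ← mul_sub, norm_mul]
  calc _ ≤ ‖exp (2 * a * ζ)‖ * (L * (‖exp (-2 * a * ζ)‖ * ‖Z ζ - Z' ζ‖)) := by gcongr
    _ = (‖exp (2 * a * ζ)‖ * ‖exp (-2 * a * ζ)‖) * (L * ‖Z ζ - Z' ζ‖) := by ring
    _ = _ := by rw [he, one_mul]

theorem norm_forcing_le (hM : Tame M L ε) {Z : ℂ → ℂ × ℂ × ℂ} {ζ : ℂ} {K : ℝ}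
    (hs : ‖exp (-ζ)‖ < ε) (hK : ‖exp (-2 * a * ζ)‖ * K < ε) (hZ : ‖Z ζ‖ ≤ K) :
    ‖forcing a M Z ζ‖ ≤ L * K := by
  have h := forcing_sub_norm_le (Z' := fun _ => 0) hM hs hK hZ
    (by simpa using (norm_nonneg _).trans hZ)
  simp only [forcing, smul_zero, hM.zero, mul_zero, sub_zero] at h
  exact h.trans (mul_le_mul_of_nonneg_left hZ hM.nonneg)

theorem ForcedSystem.differentiableOn {Ω : Set ℂ} {Z : ℂ → ℂ × ℂ × ℂ}
    (hZ : ForcedSystem a f Ω Z) : DifferentiableOn ℂ Z Ω := fun ζ hζ =>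
  ((hZ.fst ζ hζ).differentiableAt.prodMk ((hZ.snd ζ hζ).differentiableAt.prodMk
    (hZ.thd ζ hζ).differentiableAt)).differentiableWithinAt

theorem holBdd_forcing (hM : Tame M L ε) {Z : ℂ → ℂ × ℂ × ℂ} {Ω : Set ℂ} {K : ℝ}
    (hd : DifferentiableOn ℂ Z Ω) (hs : ∀ ζ ∈ Ω, ‖exp (-ζ)‖ < ε)
    (hK : ∀ ζ ∈ Ω, ‖exp (-2 * a * ζ)‖ * K < ε) (hZ : ∀ ζ ∈ Ω, ‖Z ζ‖ ≤ K) :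
    HolBdd Ω (L * K) (forcing a M Z) := by
  refine ⟨?_, fun ζ hζ => norm_forcing_le hM (hs ζ hζ) (hK ζ hζ) (hZ ζ hζ)⟩
  have he : DifferentiableOn ℂ (fun ζ : ℂ => exp (2 * a * ζ)) Ω := by fun_prop
  refine he.mul (hM.diff.comp (f := fun ζ => (exp (-ζ), exp (-2 * a * ζ) • Z ζ)) ?_
    fun ζ hζ => ?_)
  · have hs' : DifferentiableOn ℂ (fun ζ : ℂ => exp (-ζ)) Ω := by fun_prop
    have he' : DifferentiableOn ℂ (fun ζ : ℂ => exp (-2 * a * ζ)) Ω := by fun_prop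
    exact hs'.prodMk (he'.smul hd)
  · rw [mem_ball_zero_iff, Prod.norm_def]
    refine max_lt (hs ζ hζ) ?_
    rw [norm_smul]
    exact (mul_le_mul_of_nonneg_left (hZ ζ hζ) (norm_nonneg _)).trans_lt (hK ζ hζ)

theorem exists_small_strip (ha : 0 < a.re) (A B : ℝ) {η ε K : ℝ} (hη : 0 < η) (hε : 0 < ε)
    (hK : 0 < K) : ∃ R₀, ∀ R, R₀ ≤ R → ∀ ζ ∈ strip A B R,
      ‖exp (-ζ)‖ < η ∧ ‖exp (-2 * a * ζ)‖ * K < ε := by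
  obtain ⟨R₁, h1⟩ := exists_norm_exp_mul_lt (c := -1) (by simp) A B hη
  obtain ⟨R₂, h2⟩ := exists_norm_exp_mul_lt (c := -2 * a) (by simpa using ha) A B (div_pos hε hK)
  refine ⟨max R₁ R₂, fun R hR ζ hζ => ⟨?_, ?_⟩⟩
  · simpa using h1 R ((le_max_left _ _).trans hR) ζ hζ
  · exact (lt_div_iff₀ hK).1 (h2 R ((le_max_right _ _).trans hR) ζ hζ)

/-- Existence: the forcing `f` is found as the fixed point of `f ↦ forcing (forcedSol f)`, which
contracts because `forcedSol` depends on `f` through a factor `exp (-ζ)`. -/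
theorem exists_forcedSystem (ha : 0 < a.re) (hM : Tame M L ε) (A B : ℝ) (C : ℂ) :
    ∃ R K : ℝ, ∃ Z : ℂ → ℂ × ℂ × ℂ, ForcedSystem a (forcing a M Z) (strip A B R) Z ∧
      ∀ ζ ∈ strip A B R, ‖Z ζ - (C, -(1 + 2 * a) * C, 2 * a * (1 + 2 * a) * C)‖
        ≤ K * ‖exp (-ζ)‖ := by
  set Y0 : ℂ × ℂ × ℂ := (C, -(1 + 2 * a) * C, 2 * a * (1 + 2 * a) * C) with hY0
  set κ : ℝ := 2 * ‖1 / (4 * a)‖ + 1 with hκ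
  have hκ0 : 0 < κ := by positivity
  set K : ℝ := ‖Y0‖ + 1 with hK
  have hK0 : 0 < K := by positivity
  set F : ℝ := L * K with hF
  have hL := hM.nonneg
  have hF0 : 0 ≤ F := by positivity
  obtain ⟨R, hR⟩ := exists_small_strip ha A B (η := min ε (min (1 / (κ * F + 1))
    (1 / (2 * (L * κ) + 1)))) (lt_min hM.pos (lt_min (by positivity) (by positivity))) hM.pos hK0
  specialize hR R le_rfl
  have hs : ∀ ζ ∈ strip A B R, ‖exp (-ζ)‖ < ε := fun ζ hζ => (hR ζ hζ).1.trans_le (min_le_left _ _)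
  have hs1 : ∀ ζ ∈ strip A B R, κ * F * ‖exp (-ζ)‖ ≤ 1 := fun ζ hζ => by
    have h := ((hR ζ hζ).1.trans_le ((min_le_right _ _).trans (min_le_left _ _))).le
    rw [le_div_iff₀ (by positivity)] at h
    nlinarith [norm_nonneg (exp (-ζ))]
  have hs2 : ∀ ζ ∈ strip A B R, L * κ * ‖exp (-ζ)‖ ≤ 1 / 2 := fun ζ hζ => by
    have h := ((hR ζ hζ).1.trans_le ((min_le_right _ _).trans (min_le_right _ _))).le
    rw [le_div_iff₀ (by positivity)] at h
    nlinarith [norm_nonneg (exp (-ζ))]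
  have hb : ∀ f, HolBdd (strip A B R) F f → ∀ ζ ∈ strip A B R, ‖forcedSol a C f ζ‖ ≤ K := by
    intro f hf ζ hζ
    have h := (norm_forcedSol_sub_le (C := C) ha hf hζ).trans (hs1 ζ hζ)
    calc ‖forcedSol a C f ζ‖ = ‖Y0 + (forcedSol a C f ζ - Y0)‖ := by rw [add_sub_cancel]
      _ ≤ ‖Y0‖ + ‖forcedSol a C f ζ - Y0‖ := norm_add_le _ _
      _ ≤ K := by rw [hK]; gcongr
  obtain ⟨f, hf, hfix⟩ := exists_holomorphic_fixedPoint (isOpen_strip A B R) hF0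
    (fun f => forcing a M (forcedSol a C f))
    (fun f hf => holBdd_forcing hM (forcedSystem_forcedSol ha hf).differentiableOn hs
      (fun ζ hζ => (hR ζ hζ).2) (hb f hf))
    (fun f g hf hg d hd ζ hζ => by
      refine (forcing_sub_norm_le hM (hs ζ hζ) (hR ζ hζ).2 (hb f hf ζ hζ) (hb g hg ζ hζ)).trans ?_
      have hd0 : 0 ≤ d := (norm_nonneg _).trans (hd ζ hζ)
      calc _ ≤ L * (κ * d * ‖exp (-ζ)‖) := by
            gcongr
            exact forcedSol_sub_norm_le ha hf hg hd hζ
        _ = (L * κ * ‖exp (-ζ)‖) * d := by ring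
        _ ≤ 1 / 2 * d := by gcongr; exact hs2 ζ hζ
        _ = d / 2 := by ring)
  refine ⟨R, κ * F, forcedSol a C f, ?_, fun ζ hζ => norm_forcedSol_sub_le ha hf hζ⟩
  have h := forcedSystem_forcedSol (C := C) ha hf
  refine ⟨h.fst, h.snd, fun ζ hζ => ?_⟩
  rw [hfix ζ hζ]
  exact h.thd ζ hζ

/-- Uniqueness: the forcings of two bounded solutions with the same limit are fixed points of the
same contraction once `re ζ` is large. -/
theorem ForcedSystem.eqOn (ha : 0 < a.re) (hM : Tame M L ε) {Z Z' : ℂ → ℂ × ℂ × ℂ} {K : ℝ}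
    (hZ : ForcedSystem a (forcing a M Z) (strip A B R) Z)
    (hZ' : ForcedSystem a (forcing a M Z') (strip A B R) Z')
    (hK : ∀ ζ ∈ strip A B R, ‖Z ζ‖ ≤ K) (hK' : ∀ ζ ∈ strip A B R, ‖Z' ζ‖ ≤ K)
    (hC : ∀ ζ ∈ strip A B R, Tendsto (fun τ : ℝ => (Z (ζ + τ)).1) atTop (nhds C))
    (hC' : ∀ ζ ∈ strip A B R, Tendsto (fun τ : ℝ => (Z' (ζ + τ)).1) atTop (nhds C)) :
    ∃ R', R ≤ R' ∧ Set.EqOn Z Z' (strip A B R') := by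
  set κ : ℝ := 2 * ‖1 / (4 * a)‖ + 1 with hκ
  have hκ0 : 0 < κ := by positivity
  have hL := hM.nonneg
  set K₁ : ℝ := |K| + 1
  have hKK : K ≤ K₁ := (le_abs_self K).trans (by simp [K₁])
  obtain ⟨R₀, hR₀⟩ := exists_small_strip ha A B (η := min ε (1 / (2 * (L * κ) + 1)))
    (lt_min hM.pos (by positivity)) hM.pos (K := K₁) (by positivity)
  set R' := max R R₀
  have hR := hR₀ R' (le_max_right _ _)
  have hsub : strip A B R' ⊆ strip A B R := strip_mono le_rfl le_rfl (le_max_left _ _)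
  have hs : ∀ ζ ∈ strip A B R', ‖exp (-ζ)‖ < ε := fun ζ hζ => (hR ζ hζ).1.trans_le (min_le_left _ _)
  have hs2 : ∀ ζ ∈ strip A B R', L * κ * ‖exp (-ζ)‖ ≤ 1 / 2 := fun ζ hζ => by
    have h := ((hR ζ hζ).1.trans_le (min_le_right _ _)).le
    rw [le_div_iff₀ (by positivity)] at h
    nlinarith [norm_nonneg (exp (-ζ))]
  have key : ∀ {Y : ℂ → ℂ × ℂ × ℂ}, ForcedSystem a (forcing a M Y) (strip A B R) Y →
      (∀ ζ ∈ strip A B R, ‖Y ζ‖ ≤ K) →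
      (∀ ζ ∈ strip A B R, Tendsto (fun τ : ℝ => (Y (ζ + τ)).1) atTop (nhds C)) →
      HolBdd (strip A B R') (L * K₁) (forcing a M Y) ∧
        ∀ ζ ∈ strip A B R', Y ζ = forcedSol a C (forcing a M Y) ζ := by
    intro Y hY hYK hYC
    have hb : ∀ ζ ∈ strip A B R', ‖Y ζ‖ ≤ K₁ := fun ζ hζ => (hYK ζ (hsub hζ)).trans hKK
    have hhb := holBdd_forcing (a := a) hM (hY.differentiableOn.mono hsub) hs
      (fun ζ hζ => (hR ζ hζ).2) hb
    exact ⟨hhb, ForcedSystem.eq_forcedSol ha hhb ⟨fun ζ hζ => hY.fst ζ (hsub hζ),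
      fun ζ hζ => hY.snd ζ (hsub hζ), fun ζ hζ => hY.thd ζ (hsub hζ)⟩ hb
      fun ζ hζ => hYC ζ (hsub hζ)⟩
  obtain ⟨hf, hfix⟩ := key hZ hK hC
  obtain ⟨hf', hfix'⟩ := key hZ' hK' hC'
  -- The contraction halves any bound for the difference of the two forcings.
  have hhalf : ∀ n : ℕ, ∀ ζ ∈ strip A B R',
      ‖forcing a M Z ζ - forcing a M Z' ζ‖ ≤ (L * K₁ + L * K₁) * (1 / 2) ^ n := by
    intro n
    induction n with
    | zero =>
      intro ζ hζ
      simpa using (hf.sub hf').bound ζ hζ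
    | succ n ih =>
      intro ζ hζ
      refine (forcing_sub_norm_le hM (hs ζ hζ) (hR ζ hζ).2 ((hK ζ (hsub hζ)).trans hKK)
        ((hK' ζ (hsub hζ)).trans hKK)).trans ?_
      rw [hfix ζ hζ, hfix' ζ hζ]
      calc _ ≤ L * (κ * ((L * K₁ + L * K₁) * (1 / 2) ^ n) * ‖exp (-ζ)‖) := by
            gcongr
            exact forcedSol_sub_norm_le ha hf hf' ih hζ
        _ = (L * κ * ‖exp (-ζ)‖) * ((L * K₁ + L * K₁) * (1 / 2) ^ n) := by ring
        _ ≤ 1 / 2 * ((L * K₁ + L * K₁) * (1 / 2) ^ n) := by gcongr; exact hs2 ζ hζ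
        _ = _ := by ring
  have hlim : Tendsto (fun n : ℕ => (L * K₁ + L * K₁) * (1 / 2 : ℝ) ^ n) atTop (nhds 0) := by
    simpa using (tendsto_pow_atTop_nhds_zero_of_lt_one (r := (1 / 2 : ℝ)) (by norm_num)
      (by norm_num)).const_mul (L * K₁ + L * K₁)
  have heq : Set.EqOn (forcing a M Z) (forcing a M Z') (strip A B R') := fun ζ hζ =>
    sub_eq_zero.1 (norm_le_zero_iff.1
      (ge_of_tendsto hlim (Eventually.of_forall fun n => hhalf n ζ hζ)))
  refine ⟨R', le_max_left _ _, fun ζ hζ => ?_⟩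
  have h := forcedSol_sub_norm_le (C := C) ha hf hf' (d := 0)
    (fun z hz => by simp [heq hz]) hζ
  rw [hfix ζ hζ, hfix' ζ hζ]
  exact sub_eq_zero.1 (norm_le_zero_iff.1 (by simpa using h))

end

/-! ### The equation in logarithmic coordinates -/

section Algebra

variable (a c d : ℂ)

/-- The difference of the two sides of the σ-form, as a polynomial in `s = 1 / t`,
`w = u - (-a² t + (a² + c d) / 2)`, `r = t w' - w` and `q = t² w''` (where `'` is `d/dt`), so that
`t w' = w + r`. -/
noncomputable def sigmaPoly (s w r q : ℂ) : ℂ :=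
  (s * (w + r) - a ^ 2) * ((1 - s) * q) ^ 2
    + (2 * (s * (w + r) - a ^ 2) * r + (a ^ 2 - c * d) * (s * (w + r)) - (s * (w + r)) ^ 2) ^ 2
    - (s * (w + r)) ^ 2 * (s * (w + r) + c ^ 2 - a ^ 2) * (s * (w + r) + d ^ 2 - a ^ 2)

/-- The coefficient of `t d/dt q` in the third-order equation. -/
noncomputable def leadCoeff (x : ℂ × ℂ × ℂ × ℂ) : ℂ :=
  2 * (x.1 * (x.2.1 + x.2.2.1) - a ^ 2) * (1 - x.1) ^ 2

/-- The third-order equation reads `leadCoeff * (t d/dt q - 4 a² r) = s * lowerOrder`. -/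
noncomputable def lowerOrder (x : ℂ × ℂ × ℂ × ℂ) : ℂ :=
  let s := x.1
  let r := x.2.2.1
  let p := x.2.1 + x.2.2.1
  let q := x.2.2.2
  let g := 2 * p * r + (a ^ 2 - c * d) * p - s * p ^ 2
  let k := 2 * r + 2 * p + (a ^ 2 - c * d) - 2 * s * p
  2 * (s * p) * (s * p + c ^ 2 - a ^ 2) * (s * p + d ^ 2 - a ^ 2)
    + (s * p) ^ 2 * (2 * (s * p) + c ^ 2 + d ^ 2 - 2 * a ^ 2)
    - (1 - s) ^ 2 * q ^ 2 - 2 * (s * p - a ^ 2) * (1 - s) * q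
    + (4 * a ^ 2 * r * k + 4 * a ^ 2 * g - 2 * s * g * k)
    - 8 * a ^ 2 * r * (p * (1 - s) ^ 2 + a ^ 2 * (2 - s))

/-- The nonlinearity of the third-order equation `t d/dt q = 4 a² r + s M (s, w, r, q)`. -/
noncomputable def nonlin (x : ℂ × ℂ × ℂ × ℂ) : ℂ :=
  lowerOrder a c d x / leadCoeff a x

variable {a c d}

theorem exists_tame (ha : a ≠ 0) : ∃ L ε, Tame (nonlin a c d) L ε ∧
    ∀ x ∈ Metric.ball (0 : ℂ × ℂ × ℂ × ℂ) ε, leadCoeff a x ≠ 0 := by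
  have h0 : leadCoeff a 0 ≠ 0 := by simp [leadCoeff, ha]
  have hD : ContDiff ℂ 1 (leadCoeff a) := by unfold leadCoeff; fun_prop
  have hN : ContDiff ℂ 1 (lowerOrder a c d) := by unfold lowerOrder; fun_prop
  have hM : ContDiffAt ℂ 1 (nonlin a c d) 0 := hN.contDiffAt.div hD.contDiffAt h0
  obtain ⟨L, T, hT, hL⟩ := hM.exists_lipschitzOnWith
  have hne : ∀ᶠ x in nhds (0 : ℂ × ℂ × ℂ × ℂ), leadCoeff a x ≠ 0 :=
    hD.continuous.continuousAt.eventually_ne h0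
  obtain ⟨ε, hε, hball⟩ := Metric.eventually_nhds_iff_ball.1 (hne.and hT)
  refine ⟨L, ε, ⟨hε, L.2, fun x hx => ?_, fun s Z Z' hs hZ hZ' => ?_, fun s => ?_⟩,
    fun x hx => (hball x hx).1⟩
  · exact ((hN.contDiffAt.div hD.contDiffAt (hball x hx).1).differentiableAt
      one_ne_zero).differentiableWithinAt
  · have mem : ∀ Y : ℂ × ℂ × ℂ, ‖Y‖ < ε → (s, Y) ∈ T := fun Y hY =>
      (hball _ (by rw [mem_ball_zero_iff, Prod.norm_def]; exact max_lt hs hY)).2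
    have h := hL.norm_sub_le (mem Z hZ) (mem Z' hZ')
    simpa [Prod.norm_def] using h
  · simp [nonlin, lowerOrder]

/-- The derivative of the equation factors through `q`, the other factor being linear in the
highest derivative. -/
theorem hasDerivAt_sigmaPoly {w r q : ℂ → ℂ} {q' ζ : ℂ} (hw : HasDerivAt w (w ζ + r ζ) ζ)
    (hr : HasDerivAt r (q ζ) ζ) (hq : HasDerivAt q q' ζ) :
    HasDerivAt (fun z => sigmaPoly a c d (exp (-z)) (w z) (r z) (q z))
      (q ζ * (leadCoeff a (exp (-ζ), w ζ, r ζ, q ζ) * (q' - 4 * a ^ 2 * r ζ)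
        - exp (-ζ) * lowerOrder a c d (exp (-ζ), w ζ, r ζ, q ζ))) ζ := by
  have hs : HasDerivAt (fun z : ℂ => exp (-z)) (-exp (-ζ)) ζ := by
    simpa using (hasDerivAt_neg ζ).cexp
  have hsp := hs.mul (hw.add hr)
  have h1 := (hsp.sub_const (a ^ 2)).mul (((hs.const_sub 1).mul hq).pow 2)
  have h2 := ((((hsp.sub_const (a ^ 2)).const_mul 2).mul hr).add
    (hsp.const_mul (a ^ 2 - c * d))).sub (hsp.pow 2)
  have h3 := ((hsp.pow 2).mul ((hsp.add_const (c ^ 2)).sub_const (a ^ 2))).mul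
    ((hsp.add_const (d ^ 2)).sub_const (a ^ 2))
  convert! (h1.add (h2.pow 2)).sub h3 using 1
  simp only [leadCoeff, lowerOrder, Pi.mul_apply, Pi.add_apply, Pi.sub_apply, Pi.pow_apply]
  push_cast
  ring

theorem sigmaPVI_iff {Ω : Set ℂ} (hΩ : IsOpen Ω) {u w r q : ℂ → ℂ}
    (hu : ∀ ζ ∈ Ω, u ζ = -a ^ 2 * exp ζ + (1 / 2) * (a ^ 2 + c * d) + w ζ)
    (hw : ∀ ζ ∈ Ω, HasDerivAt w (w ζ + r ζ) ζ) (hr : ∀ ζ ∈ Ω, HasDerivAt r (q ζ) ζ) {ζ : ℂ}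
    (hζ : ζ ∈ Ω) :
    SigmaPVI a c d u ζ ↔ sigmaPoly a c d (exp (-ζ)) (w ζ) (r ζ) (q ζ) = 0 := by
  have hst : ∀ z : ℂ, exp (-z) * exp z = 1 := fun z => by rw [← exp_add]; simp
  have h1 : ∀ z ∈ Ω, tDeriv u z = -a ^ 2 + exp (-z) * (w z + r z) := by
    intro z hz
    have hd : HasDerivAt u (-a ^ 2 * exp z + (w z + r z)) z := by
      have h := (((hasDerivAt_exp z).const_mul (-a ^ 2)).add_const
        ((1 / 2) * (a ^ 2 + c * d))).add (hw z hz)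
      refine h.congr_of_eventuallyEq ?_
      filter_upwards [hΩ.mem_nhds hz] with y hy
      exact hu y hy
    rw [tDeriv, hd.deriv]
    linear_combination (-a ^ 2) * hst z
  have h2 : tDeriv (tDeriv u) ζ = exp (-ζ) ^ 2 * q ζ := by
    have hs : HasDerivAt (fun z : ℂ => exp (-z)) (-exp (-ζ)) ζ := by
      simpa using (hasDerivAt_neg ζ).cexp
    have hd : HasDerivAt (tDeriv u) (exp (-ζ) * q ζ) ζ := by
      have h := (hs.mul ((hw ζ hζ).add (hr ζ hζ))).const_add (-a ^ 2)
      refine (h.congr_of_eventuallyEq ?_).congr_deriv ?_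
      · filter_upwards [hΩ.mem_nhds hζ] with y hy
        exact h1 y hy
      · simp only [Pi.add_apply]
        ring
    rw [tDeriv, hd.deriv]
    ring
  have ht : exp ζ = (exp (-ζ))⁻¹ := by rw [exp_neg, inv_inv]
  have hs0 : exp (-ζ) ≠ 0 := exp_ne_zero _
  simp only [SigmaPVI, h1 ζ hζ, h2, hu ζ hζ, ht]
  generalize exp (-ζ) = s at hs0 ⊢
  rw [← sub_eq_zero]
  refine Eq.congr_left ?_
  rw [sigmaPoly]
  field_simp
  ring

/-! ### Passing to the rescaled unknown -/

theorem hasDerivAt_exp_mul (b ζ : ℂ) : HasDerivAt (fun z => exp (b * z)) (b * exp (b * ζ)) ζ := by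
  convert! ((hasDerivAt_id ζ).const_mul b).cexp using 1
  simp [mul_comm]

theorem exp_two_mul_mul_exp_neg (a ζ : ℂ) : exp (2 * a * ζ) * exp (-2 * a * ζ) = 1 := by
  rw [← exp_add]; simp

section Unscale

variable {Ω : Set ℂ} {f : ℂ → ℂ} {Z : ℂ → ℂ × ℂ × ℂ} {ζ : ℂ}

theorem hasDerivAt_unscaled_fst
    (h : HasDerivAt (fun z => (Z z).1) ((1 + 2 * a) * (Z ζ).1 + (Z ζ).2.1) ζ) :
    HasDerivAt (fun z => exp (-2 * a * z) * (Z z).1)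
      (exp (-2 * a * ζ) * (Z ζ).1 + exp (-2 * a * ζ) * (Z ζ).2.1) ζ := by
  convert! (hasDerivAt_exp_mul (-2 * a) ζ).mul h using 1
  ring

theorem hasDerivAt_unscaled_snd
    (h : HasDerivAt (fun z => (Z z).2.1) (2 * a * (Z ζ).2.1 + (Z ζ).2.2) ζ) :
    HasDerivAt (fun z => exp (-2 * a * z) * (Z z).2.1) (exp (-2 * a * ζ) * (Z ζ).2.2) ζ := by
  convert! (hasDerivAt_exp_mul (-2 * a) ζ).mul h using 1
  ring

theorem hasDerivAt_unscaled_thd {Q' : ℂ} (h : HasDerivAt (fun z => (Z z).2.2) Q' ζ) :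
    HasDerivAt (fun z => exp (-2 * a * z) * (Z z).2.2)
      (exp (-2 * a * ζ) * (Q' - 2 * a * (Z ζ).2.2)) ζ := by
  convert! (hasDerivAt_exp_mul (-2 * a) ζ).mul h using 1
  ring

/-- Along a ray a bounded function times `t ^ (-2 a)` tends to zero. -/
theorem tendsto_unscaled {A B R K : ℝ} {g : ℂ → ℂ} (ha : 0 < a.re)
    (hK : ∀ ζ ∈ strip A B R, ‖g ζ‖ ≤ K) (hζ : ζ ∈ strip A B R) :
    Tendsto (fun τ : ℝ => exp (-2 * a * (ζ + τ)) * g (ζ + τ)) atTop (nhds 0) := by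
  refine (tendsto_exp_mul_ray (by simpa using ha) ζ).zero_mul_isBoundedUnder_le ⟨K, ?_⟩
  rw [eventually_map]
  filter_upwards [eventually_ge_atTop 0] with τ hτ
  exact hK _ (add_ofReal_mem_strip hζ hτ)

/-- A bounded solution of the third-order equation solves the σ-form: the defect is a first
integral, and it tends to zero along rays. -/
theorem sigmaPoly_eq_zero {A B R K : ℝ} (ha : 0 < a.re)
    (hZ : ForcedSystem a (forcing a (nonlin a c d) Z) (strip A B R) Z)
    (hK : ∀ ζ ∈ strip A B R, ‖Z ζ‖ ≤ K)
    (hD : ∀ ζ ∈ strip A B R, leadCoeff a (exp (-ζ), exp (-2 * a * ζ) • Z ζ) ≠ 0)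
    (hζ : ζ ∈ strip A B R) :
    sigmaPoly a c d (exp (-ζ)) (exp (-2 * a * ζ) * (Z ζ).1) (exp (-2 * a * ζ) * (Z ζ).2.1)
      (exp (-2 * a * ζ) * (Z ζ).2.2) = 0 := by
  set Φ : ℂ → ℂ := fun z => sigmaPoly a c d (exp (-z)) (exp (-2 * a * z) * (Z z).1)
    (exp (-2 * a * z) * (Z z).2.1) (exp (-2 * a * z) * (Z z).2.2) with hΦ
  obtain ⟨k, hk⟩ := eq_const_of_hasDerivAt_zero (A := A) (B := B) (R := R) (h := Φ) (by
    intro z hz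
    refine (hasDerivAt_sigmaPoly (hasDerivAt_unscaled_fst (hZ.fst z hz))
      (hasDerivAt_unscaled_snd (hZ.snd z hz))
      (hasDerivAt_unscaled_thd (hZ.thd z hz))).congr_deriv ?_
    have hne := hD z hz
    have hx : ((exp (-z), exp (-2 * a * z) • Z z) : ℂ × ℂ × ℂ × ℂ) =
      (exp (-z), exp (-2 * a * z) * (Z z).1, exp (-2 * a * z) * (Z z).2.1,
        exp (-2 * a * z) * (Z z).2.2) := rfl
    rw [hx] at hne
    have he := exp_two_mul_mul_exp_neg a z
    simp only [forcing, hx, nonlin]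
    generalize lowerOrder a c d _ = N
    generalize leadCoeff a _ = D at hne ⊢
    linear_combination (exp (-2 * a * z) * (Z z).2.2 * exp (-z) * N) * he
      + (exp (-2 * a * z) * (Z z).2.2 * exp (-z) * exp (-2 * a * z) * exp (2 * a * z))
        * mul_div_cancel₀ N hne)
  have hcont : Continuous fun x : ℂ × ℂ × ℂ × ℂ => sigmaPoly a c d x.1 x.2.1 x.2.2.1 x.2.2.2 := by
    unfold sigmaPoly; fun_prop
  have b1 : ∀ ζ ∈ strip A B R, ‖(Z ζ).1‖ ≤ K := fun ζ hζ => (norm_fst_le _).trans (hK ζ hζ)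
  have b2 : ∀ ζ ∈ strip A B R, ‖(Z ζ).2.1‖ ≤ K := fun ζ hζ =>
    (norm_fst_le _).trans ((norm_snd_le _).trans (hK ζ hζ))
  have b3 : ∀ ζ ∈ strip A B R, ‖(Z ζ).2.2‖ ≤ K := fun ζ hζ =>
    (norm_snd_le _).trans ((norm_snd_le _).trans (hK ζ hζ))
  have hlim : Tendsto (fun τ : ℝ => Φ (ζ + τ)) atTop (nhds 0) := by
    have h := (hcont.tendsto (0, 0, 0, 0)).comp ((tendsto_exp_neg_ray ζ).prodMk_nhds
      ((tendsto_unscaled ha b1 hζ).prodMk_nhds ((tendsto_unscaled ha b2 hζ).prodMk_nhds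
        (tendsto_unscaled ha b3 hζ))))
    have h0 : sigmaPoly a c d 0 0 0 0 = 0 := by simp [sigmaPoly]
    simp only [h0] at h
    exact h
  have hlim' : Tendsto (fun τ : ℝ => Φ (ζ + τ)) atTop (nhds k) :=
    tendsto_const_nhds.congr' (by
      filter_upwards [eventually_ge_atTop 0] with τ hτ
      exact (hk _ (add_ofReal_mem_strip hζ hτ)).symm)
  exact (hk ζ hζ).trans (tendsto_nhds_unique hlim' hlim)

/-- Conversely, the σ-form implies the third-order equation. The factor `q` may vanish identically,
but then a bounded solution is zero. -/
theorem ForcedSystem.of_sigmaPoly {A B R K : ℝ} (ha : 0 < a.re)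
    (h1 : ∀ ζ ∈ strip A B R, HasDerivAt (fun z => (Z z).1) ((1 + 2 * a) * (Z ζ).1 + (Z ζ).2.1) ζ)
    (h2 : ∀ ζ ∈ strip A B R, HasDerivAt (fun z => (Z z).2.1) (2 * a * (Z ζ).2.1 + (Z ζ).2.2) ζ)
    (h3 : DifferentiableOn ℂ (fun z => (Z z).2.2) (strip A B R))
    (hK : ∀ ζ ∈ strip A B R, ‖Z ζ‖ ≤ K)
    (hw : ∀ ζ ∈ strip A B R, ‖exp (-2 * a * ζ)‖ * K ≤ 1)
    (hD : ∀ ζ ∈ strip A B R, leadCoeff a (exp (-ζ), exp (-2 * a * ζ) • Z ζ) ≠ 0)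
    (hσ : ∀ ζ ∈ strip A B R, sigmaPoly a c d (exp (-ζ)) (exp (-2 * a * ζ) * (Z ζ).1)
      (exp (-2 * a * ζ) * (Z ζ).2.1) (exp (-2 * a * ζ) * (Z ζ).2.2) = 0) :
    ForcedSystem a (forcing a (nonlin a c d) Z) (strip A B R) Z := by
  have hΩ := isOpen_strip A B R
  have hQ : ∀ ζ ∈ strip A B R, HasDerivAt (fun z => (Z z).2.2) (deriv (fun z => (Z z).2.2) ζ) ζ :=
    fun ζ hζ => (h3.differentiableAt (hΩ.mem_nhds hζ)).hasDerivAt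
  set w : ℂ → ℂ := fun z => exp (-2 * a * z) * (Z z).1 with hwdef
  set r : ℂ → ℂ := fun z => exp (-2 * a * z) * (Z z).2.1 with hrdef
  set q : ℂ → ℂ := fun z => exp (-2 * a * z) * (Z z).2.2 with hqdef
  set q' : ℂ → ℂ := fun z => exp (-2 * a * z) *
    (deriv (fun z => (Z z).2.2) z - 2 * a * (Z z).2.2) with hq'def
  have dw : ∀ ζ ∈ strip A B R, HasDerivAt w (w ζ + r ζ) ζ := fun ζ hζ =>
    hasDerivAt_unscaled_fst (h1 ζ hζ)
  have dr : ∀ ζ ∈ strip A B R, HasDerivAt r (q ζ) ζ := fun ζ hζ =>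
    hasDerivAt_unscaled_snd (h2 ζ hζ)
  have dq : ∀ ζ ∈ strip A B R, HasDerivAt q (q' ζ) ζ := fun ζ hζ =>
    hasDerivAt_unscaled_thd (hQ ζ hζ)
  set E : ℂ → ℂ := fun ζ => leadCoeff a (exp (-ζ), w ζ, r ζ, q ζ) * (q' ζ - 4 * a ^ 2 * r ζ)
        - exp (-ζ) * lowerOrder a c d (exp (-ζ), w ζ, r ζ, q ζ) with hE
  have hqE : ∀ ζ ∈ strip A B R, q ζ • E ζ = 0 := by
    intro ζ hζ
    have h := hasDerivAt_sigmaPoly (c := c) (d := d) (a := a) (dw ζ hζ) (dr ζ hζ) (dq ζ hζ)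
    refine h.unique ((hasDerivAt_const ζ (0 : ℂ)).congr_of_eventuallyEq ?_)
    filter_upwards [hΩ.mem_nhds hζ] with z hz
    exact hσ z hz
  have hwd : DifferentiableOn ℂ w (strip A B R) := fun ζ hζ =>
    (dw ζ hζ).differentiableAt.differentiableWithinAt
  have hrd : DifferentiableOn ℂ r (strip A B R) := fun ζ hζ =>
    (dr ζ hζ).differentiableAt.differentiableWithinAt
  have hqd : DifferentiableOn ℂ q (strip A B R) := fun ζ hζ =>
    (dq ζ hζ).differentiableAt.differentiableWithinAt
  have hq'd : DifferentiableOn ℂ q' (strip A B R) :=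
    DifferentiableOn.mul (by fun_prop) ((h3.deriv hΩ).sub (h3.const_mul _))
  have hEd : DifferentiableOn ℂ E (strip A B R) := by
    simp only [hE, leadCoeff, lowerOrder]
    fun_prop
  have heq : ∀ ζ ∈ strip A B R,
      q' ζ = 4 * a ^ 2 * r ζ + exp (-ζ) * nonlin a c d (exp (-ζ), w ζ, r ζ, q ζ) := by
    rcases AnalyticOnNhd.eq_zero_or_eq_zero_of_smul_eq_zero (hqd.analyticOnNhd hΩ)
      (hEd.analyticOnNhd hΩ) hqE (isPreconnected_strip A B R) with hq0 | hE0
    -- If `q = 0` then `r` is constant and decays, so `r = 0`; hence `dw/dζ = w` and `w = 0`.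
    · obtain ⟨k, hk⟩ := eq_const_of_hasDerivAt_zero (A := A) (B := B) (R := R) (h := r)
        (fun z hz => by rw [← hq0 z hz]; exact dr z hz)
      have hr0 : ∀ ζ ∈ strip A B R, r ζ = 0 := by
        intro ζ hζ
        have hl : Tendsto (fun τ : ℝ => r (ζ + τ)) atTop (nhds 0) :=
          tendsto_unscaled (g := fun z => (Z z).2.1) ha (fun ζ hζ =>
            (norm_fst_le _).trans ((norm_snd_le _).trans (hK ζ hζ))) hζ
        have hl' : Tendsto (fun τ : ℝ => r (ζ + τ)) atTop (nhds k) :=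
          tendsto_const_nhds.congr' (by
            filter_upwards [eventually_ge_atTop 0] with τ hτ
            exact (hk _ (add_ofReal_mem_strip hζ hτ)).symm)
        exact (hk ζ hζ).trans (tendsto_nhds_unique hl' hl)
      have hw0 : ∀ ζ ∈ strip A B R, w ζ = 0 := fun ζ hζ =>
        eq_zero_of_hasDerivAt_mul (l := 1) (F := 1) (by simp)
          (fun z hz => by simpa [hr0 z hz] using dw z hz)
          (fun z hz => by
            rw [hwdef, norm_mul]
            exact (mul_le_mul_of_nonneg_left ((norm_fst_le _).trans (hK z hz))
              (norm_nonneg _)).trans (hw z hz)) hζ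
      intro ζ hζ
      have hq'0 : q' ζ = 0 := by
        refine (dq ζ hζ).unique ((hasDerivAt_const ζ (0 : ℂ)).congr_of_eventuallyEq ?_)
        filter_upwards [hΩ.mem_nhds hζ] with z hz
        exact hq0 z hz
      simp [hq'0, hr0 ζ hζ, hw0 ζ hζ, hq0 ζ hζ, nonlin, lowerOrder]
    · intro ζ hζ
      have hne : leadCoeff a (exp (-ζ), w ζ, r ζ, q ζ) ≠ 0 := hD ζ hζ
      have h := hE0 ζ hζ
      simp only [hE] at h
      rw [nonlin]
      field_simp
      linear_combination h
  refine ⟨h1, h2, fun ζ hζ => (hQ ζ hζ).congr_deriv ?_⟩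
  have he := exp_two_mul_mul_exp_neg a ζ
  have h : exp (-2 * a * ζ) * (deriv (fun z => (Z z).2.2) ζ - 2 * a * (Z ζ).2.2) =
      4 * a ^ 2 * (exp (-2 * a * ζ) * (Z ζ).2.1) +
        exp (-ζ) * nonlin a c d (exp (-ζ), exp (-2 * a * ζ) • Z ζ) := heq ζ hζ
  rw [forcing]
  linear_combination exp (2 * a * ζ) * h - (deriv (fun z => (Z z).2.2) ζ - 2 * a * (Z ζ).2.2 -
    4 * a ^ 2 * (Z ζ).2.1) * he

end Unscale

/-! ### From the expansion to the rescaled system -/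

theorem eventually_atInfty {A B : ℝ} {P : ℂ → Prop} :
    (∀ᶠ ζ in atInfty A B, P ζ) ↔ ∃ R, ∀ ζ ∈ strip A B R, P ζ := by
  rw [atInfty, eventually_inf_principal, eventually_comap]
  constructor
  · intro h
    obtain ⟨x, hx⟩ := eventually_atTop.1 h
    refine ⟨Real.log (max x 1), fun ζ hζ => hx _ ?_ ζ rfl ⟨hζ.1, hζ.2.1⟩⟩
    rw [norm_exp]
    exact (le_max_left _ _).trans
      ((Real.log_lt_iff_lt_exp (zero_lt_one.trans_le (le_max_right x 1))).1 hζ.2.2).le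
  · rintro ⟨R, hR⟩
    filter_upwards [eventually_gt_atTop (Real.exp R)] with b hb ζ hζ hAB
    refine hR ζ ⟨hAB.1, hAB.2, ?_⟩
    rw [← hζ, norm_exp] at hb
    exact Real.exp_lt_exp.1 hb

theorem tendsto_ray_atInfty {A B R : ℝ} {ζ : ℂ} (hζ : ζ ∈ strip A B R) :
    Tendsto (fun τ : ℝ => ζ + τ) atTop (atInfty A B) := by
  intro S hS
  obtain ⟨R', hR'⟩ := eventually_atInfty.1 (show ∀ᶠ z in atInfty A B, z ∈ S from hS)
  change ∀ᶠ τ : ℝ in atTop, ζ + (τ : ℂ) ∈ S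
  filter_upwards [eventually_gt_atTop (R' - ζ.re)] with τ hτ
  refine hR' _ ⟨by simpa using hζ.1, by simpa using hζ.2.1, ?_⟩
  simp only [add_re, ofReal_re]
  linarith

/-- In a slightly smaller sector, Cauchy estimates bound `t d/dt` and `(t d/dt)²` of
`t ^ (2 a) w`, so that a solution with the given expansion gives a bounded solution of the
rescaled system. -/
theorem exists_forcedSystem_of_solution {A B ρ L ε η : ℝ} {C : ℂ} {v : ℂ → ℂ} (ha : 0 < a.re)
    (hM : Tame (nonlin a c d) L ε)
    (hD : ∀ x ∈ Metric.ball (0 : ℂ × ℂ × ℂ × ℂ) ε, leadCoeff a x ≠ 0) (hη : 0 < η) (hρ : 0 < ρ)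
    (hv : IsSolution a c d A B ρ v) (hexp : HasExpansion a c d C A B v) :
    ∃ R₀ K : ℝ, ∃ Z : ℂ → ℂ × ℂ × ℂ, ∀ R, R₀ ≤ R →
      ForcedSystem a (forcing a (nonlin a c d) Z) (strip (A + η + η) (B - η - η) R) Z ∧
      (∀ ζ ∈ strip (A + η + η) (B - η - η) R, ‖Z ζ‖ ≤ K) ∧
      (∀ ζ ∈ strip (A + η + η) (B - η - η) R,
        Tendsto (fun τ : ℝ => (Z (ζ + τ)).1) atTop (nhds C)) ∧
      ∀ ζ, v ζ = -a ^ 2 * exp ζ + (1 / 2) * (a ^ 2 + c * d) + exp (-2 * a * ζ) * (Z ζ).1 := by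
  set W : ℂ → ℂ := fun ζ =>
    exp (2 * a * ζ) * (v ζ - (-a ^ 2 * exp ζ + (1 / 2) * (a ^ 2 + c * d))) with hW
  have hWC : ∀ ζ, W ζ - C = remainder a c d C v ζ / exp (-2 * a * ζ) := by
    intro ζ
    have he := exp_two_mul_mul_exp_neg a ζ
    rw [eq_div_iff (exp_ne_zero _), remainder, hW]
    linear_combination (v ζ - (-a ^ 2 * exp ζ + 1 / 2 * (a ^ 2 + c * d))) * he
  have hlim : Tendsto W (atInfty A B) (nhds C) := by
    rw [tendsto_iff_norm_sub_tendsto_zero]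
    simp_rw [hWC]
    simpa using hexp.tendsto_div_nhds_zero.norm
  have hlim1 : ∀ᶠ ζ in atInfty A B, ‖W ζ‖ < ‖C‖ + 1 :=
    hlim.norm.eventually_lt_const (by linarith)
  obtain ⟨R₁, hR₁⟩ := eventually_atInfty.1 hlim1
  rw [IsSolution, ← Real.exp_log hρ, sector_exp] at hv
  obtain ⟨hvd, hvσ⟩ := hv
  set R₂ := max R₁ (Real.log ρ) with hR₂
  have hsub2 : strip A B R₂ ⊆ strip A B (Real.log ρ) :=
    strip_mono le_rfl le_rfl (le_max_right _ _)
  have b0 : HolBdd (strip A B R₂) (‖C‖ + 1) W := by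
    refine ⟨?_, fun ζ hζ => (hR₁ ζ (strip_mono le_rfl le_rfl (le_max_left _ _) hζ)).le⟩
    exact DifferentiableOn.mul (by fun_prop) ((hvd.mono hsub2).sub (by fun_prop))
  have b1 := b0.deriv hη
  have b2 := b1.deriv hη
  set A' := A + η + η with hA'
  set B' := B - η - η with hB'
  set R₃ := R₂ + η + η with hR₃
  have b1' := b1.mono (strip_mono (A := A + η) (B := B - η) (R := R₂ + η) (A' := A') (B' := B')
    (R' := R₃) (by linarith) (by linarith) (by linarith))
  have b0' := b0.mono (strip_mono (A := A) (B := B) (R := R₂) (A' := A') (B' := B')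
    (R' := R₃) (by linarith) (by linarith) (by linarith))
  have dW : ∀ ζ ∈ strip A' B' R₃, HasDerivAt W (deriv W ζ) ζ := fun ζ hζ =>
    (b0'.diff.differentiableAt ((isOpen_strip _ _ _).mem_nhds hζ)).hasDerivAt
  have dW' : ∀ ζ ∈ strip A' B' R₃, HasDerivAt (deriv W) (deriv (deriv W) ζ) ζ := fun ζ hζ =>
    (b1'.diff.differentiableAt ((isOpen_strip _ _ _).mem_nhds hζ)).hasDerivAt
  set Z : ℂ → ℂ × ℂ × ℂ := fun ζ => (W ζ, deriv W ζ - (1 + 2 * a) * W ζ,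
    deriv (deriv W) ζ - (1 + 2 * a) * deriv W ζ - 2 * a * (deriv W ζ - (1 + 2 * a) * W ζ)) with hZ
  obtain ⟨K, hK⟩ : ∃ K, ∀ ζ ∈ strip A' B' R₃, ‖Z ζ‖ ≤ K := by
    set k0 := ‖C‖ + 1
    set k1 := k0 / η
    set k2 := k1 / η
    have hk1 : ∀ ζ ∈ strip A' B' R₃, ‖deriv W ζ - (1 + 2 * a) * W ζ‖ ≤ k1 + ‖1 + 2 * a‖ * k0 :=
      fun ζ hζ => (norm_sub_le _ _).trans (add_le_add (b1'.bound ζ hζ) (by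
        rw [norm_mul]; gcongr; exact b0'.bound ζ hζ))
    refine ⟨max k0 (max (k1 + ‖1 + 2 * a‖ * k0)
      (k2 + ‖1 + 2 * a‖ * k1 + ‖2 * a‖ * (k1 + ‖1 + 2 * a‖ * k0))), fun ζ hζ => ?_⟩
    rw [Prod.norm_def, Prod.norm_def]
    refine max_le_max (b0'.bound ζ hζ) (max_le_max (hk1 ζ hζ) ?_)
    refine (norm_sub_le _ _).trans (add_le_add ((norm_sub_le _ _).trans
      (add_le_add (b2.bound ζ hζ) ?_)) ?_)
    · rw [norm_mul]; gcongr; exact b1'.bound ζ hζ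
    · rw [norm_mul]; gcongr; exact hk1 ζ hζ
  obtain ⟨R₄, hR₄⟩ := exists_small_strip ha A' B' (η := ε) (ε := min ε 1) (K := |K| + 1) hM.pos
    (lt_min hM.pos zero_lt_one) (by positivity)
  have hveq : ∀ ζ, v ζ = -a ^ 2 * exp ζ + (1 / 2) * (a ^ 2 + c * d)
      + exp (-2 * a * ζ) * (Z ζ).1 := by
    intro ζ
    have he := exp_two_mul_mul_exp_neg a ζ
    simp only [hZ, hW]
    linear_combination -(v ζ - (-a ^ 2 * exp ζ + 1 / 2 * (a ^ 2 + c * d))) * he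
  refine ⟨max R₃ R₄, |K| + 1, Z, fun R hR => ?_⟩
  have hsub : strip A' B' R ⊆ strip A' B' R₃ :=
    strip_mono le_rfl le_rfl ((le_max_left _ _).trans hR)
  have hR5 := hR₄ R ((le_max_right _ _).trans hR)
  have hKR : ∀ ζ ∈ strip A' B' R, ‖Z ζ‖ ≤ |K| + 1 := fun ζ hζ =>
    (hK ζ (hsub hζ)).trans ((le_abs_self K).trans (by linarith))
  have d1 : ∀ ζ ∈ strip A' B' R,
      HasDerivAt (fun z => (Z z).1) ((1 + 2 * a) * (Z ζ).1 + (Z ζ).2.1) ζ := fun ζ hζ =>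
    (dW ζ (hsub hζ)).congr_deriv (by simp only [hZ]; ring)
  have d2 : ∀ ζ ∈ strip A' B' R,
      HasDerivAt (fun z => (Z z).2.1) (2 * a * (Z ζ).2.1 + (Z ζ).2.2) ζ := fun ζ hζ =>
    ((dW' ζ (hsub hζ)).sub ((dW ζ (hsub hζ)).const_mul (1 + 2 * a))).congr_deriv
      (by simp only [hZ]; ring)
  refine ⟨ForcedSystem.of_sigmaPoly ha d1 d2 ?_ hKR
    (fun ζ hζ => ((hR5 ζ hζ).2.trans_le (min_le_right _ _)).le) (fun ζ hζ => hD _ ?_)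
    (fun ζ hζ => ?_), hKR, fun ζ hζ => ?_, hveq⟩
  · have e0 := b0'.diff.mono hsub
    have e1 := b1'.diff.mono hsub
    have e2 := b2.diff.mono hsub
    exact (e2.sub (e1.const_mul _)).sub ((e1.sub (e0.const_mul _)).const_mul _)
  · rw [mem_ball_zero_iff, Prod.norm_def]
    refine max_lt (hR5 ζ hζ).1 ?_
    rw [norm_smul]
    exact (mul_le_mul_of_nonneg_left (hKR ζ hζ) (norm_nonneg _)).trans_lt
      ((hR5 ζ hζ).2.trans_le (min_le_left _ _))
  · refine (sigmaPVI_iff (isOpen_strip A' B' R) (u := v) (fun z _ => hveq z)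
      (fun z hz => hasDerivAt_unscaled_fst (d1 z hz))
      (fun z hz => hasDerivAt_unscaled_snd (d2 z hz)) hζ).1 (hvσ ζ ?_)
    exact strip_mono (by linarith) (by linarith)
      ((le_max_right _ _).trans (by linarith)) (hsub hζ)
  · exact hlim.comp (tendsto_ray_atInfty (A := A) (B := B) (R := R)
      (strip_mono (by linarith) (by linarith) le_rfl hζ))

/-- Two solutions with the same expansion agree far out in a smaller sector, hence everywhere by
the identity theorem. -/
theorem eqOn_of_hasExpansion {A B ρ ρ' : ℝ} {C : ℂ} {u v : ℂ → ℂ} (ha : 0 < a.re) (hAB : A < B)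
    (hρ : 0 < ρ) (hρ' : 0 < ρ') (hu : IsSolution a c d A B ρ u)
    (hv : IsSolution a c d A B ρ' v) (hue : HasExpansion a c d C A B u)
    (hve : HasExpansion a c d C A B v) : Set.EqOn v u (sector A B (max ρ ρ')) := by
  have ha0 : a ≠ 0 := fun h => by simp [h] at ha
  obtain ⟨L, ε, hM, hD⟩ := exists_tame (c := c) (d := d) ha0
  -- `η` is cut off twice on either side, once for each Cauchy estimate.
  set η := (B - A) / 8 with hη
  have hη0 : 0 < η := by rw [hη]; linarith
  obtain ⟨R₁, K₁, Z₁, h1⟩ := exists_forcedSystem_of_solution ha hM hD hη0 hρ hu hue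
  obtain ⟨R₂, K₂, Z₂, h2⟩ := exists_forcedSystem_of_solution ha hM hD hη0 hρ' hv hve
  obtain ⟨s1, k1, l1, e1⟩ := h1 (max R₁ R₂) (le_max_left _ _)
  obtain ⟨s2, k2, l2, e2⟩ := h2 (max R₁ R₂) (le_max_right _ _)
  obtain ⟨R, -, hR⟩ := ForcedSystem.eqOn (K := max K₁ K₂) ha hM s1 s2
    (fun ζ hζ => (k1 ζ hζ).trans (le_max_left _ _))
    (fun ζ hζ => (k2 ζ hζ).trans (le_max_right _ _)) l1 l2
  have hmax : 0 < max ρ ρ' := hρ.trans_le (le_max_left _ _)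
  have hsec : ∀ σ, σ ≤ max ρ ρ' → sector A B (max ρ ρ') ⊆ sector A B σ := fun σ hσ ζ hζ =>
    ⟨hζ.1, hζ.2.1, hσ.trans_lt hζ.2.2⟩
  have hdu := hu.1.mono (hsec ρ (le_max_left _ _))
  have hdv := hv.1.mono (hsec ρ' (le_max_right _ _))
  rw [← Real.exp_log hmax, sector_exp] at hdu hdv ⊢
  set T := Real.log (max ρ ρ')
  obtain ⟨z, hz⟩ := strip_nonempty (A := A + η + η) (B := B - η - η)
    (by rw [hη]; linarith) (max R T)
  have hzT : z ∈ strip A B T := strip_mono (by linarith) (by linarith) (le_max_right _ _) hz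
  refine (hdv.analyticOnNhd (isOpen_strip _ _ _)).eqOn_of_preconnected_of_eventuallyEq
    (hdu.analyticOnNhd (isOpen_strip _ _ _)) (isPreconnected_strip _ _ _) hzT ?_
  filter_upwards [(isOpen_strip _ _ _).mem_nhds hz] with y hy
  rw [e1 y, e2 y, hR (strip_mono le_rfl le_rfl (le_max_left _ _) hy)]

/-- The solution is `-a² t + (a² + c d) / 2 + t ^ (-2 a) W` with `W → C`, the relative error
`O(1 / t)` of `W` being that of `exists_forcedSystem`. -/
theorem exists_solution (ha : 0 < a.re) (A B : ℝ) (C : ℂ) :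
    ∃ ρ : ℝ, 0 < ρ ∧ ∃ u : ℂ → ℂ, IsSolution a c d A B ρ u ∧ HasExpansion a c d C A B u ∧
      remainder a c d C u =O[atInfty A B] (fun ζ => exp ((-1 - 2 * a) * ζ)) := by
  have ha0 : a ≠ 0 := fun h => by simp [h] at ha
  obtain ⟨L, ε, hM, hD⟩ := exists_tame (c := c) (d := d) ha0
  obtain ⟨R₁, K, Z, hZ, hK⟩ := exists_forcedSystem ha hM A B C
  set Y0 : ℂ × ℂ × ℂ := (C, -(1 + 2 * a) * C, 2 * a * (1 + 2 * a) * C) with hY0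
  set K' := ‖Y0‖ + |K| * Real.exp (-R₁) + 1 with hK'
  have hK'0 : 0 < K' := by positivity
  have hb : ∀ ζ ∈ strip A B R₁, ‖Z ζ‖ ≤ K' := by
    intro ζ hζ
    have hs : ‖exp (-ζ)‖ ≤ Real.exp (-R₁) := by
      rw [norm_exp]; simpa using hζ.2.2.le
    calc ‖Z ζ‖ = ‖Y0 + (Z ζ - Y0)‖ := by rw [add_sub_cancel]
      _ ≤ ‖Y0‖ + ‖Z ζ - Y0‖ := norm_add_le _ _
      _ ≤ ‖Y0‖ + |K| * Real.exp (-R₁) := by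
        gcongr
        refine (hK ζ hζ).trans ?_
        gcongr
        exact le_abs_self _
      _ ≤ K' := by rw [hK']; linarith
  obtain ⟨R₂, hR₂⟩ := exists_small_strip ha A B hM.pos hM.pos hK'0
  set R := max R₁ R₂ with hR
  have hsub : strip A B R ⊆ strip A B R₁ := strip_mono le_rfl le_rfl (le_max_left _ _)
  have hsm := hR₂ R (le_max_right _ _)
  have hZR : ForcedSystem a (forcing a (nonlin a c d) Z) (strip A B R) Z :=
    ⟨fun ζ hζ => hZ.fst ζ (hsub hζ), fun ζ hζ => hZ.snd ζ (hsub hζ),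
      fun ζ hζ => hZ.thd ζ (hsub hζ)⟩
  have hbR : ∀ ζ ∈ strip A B R, ‖Z ζ‖ ≤ K' := fun ζ hζ => hb ζ (hsub hζ)
  have hDR : ∀ ζ ∈ strip A B R, leadCoeff a (exp (-ζ), exp (-2 * a * ζ) • Z ζ) ≠ 0 := by
    intro ζ hζ
    refine hD _ ?_
    rw [mem_ball_zero_iff, Prod.norm_def]
    refine max_lt (hsm ζ hζ).1 ?_
    rw [norm_smul]
    exact (mul_le_mul_of_nonneg_left (hbR ζ hζ) (norm_nonneg _)).trans_lt (hsm ζ hζ).2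
  set u : ℂ → ℂ := fun ζ =>
    -a ^ 2 * exp ζ + (1 / 2) * (a ^ 2 + c * d) + exp (-2 * a * ζ) * (Z ζ).1 with hu
  have hrem : ∀ ζ, remainder a c d C u ζ = exp (-2 * a * ζ) * ((Z ζ).1 - C) := by
    intro ζ
    simp only [remainder, hu]
    ring
  have hremb : ∀ ζ ∈ strip A B R,
      ‖remainder a c d C u ζ‖ ≤ ‖exp (-2 * a * ζ)‖ * (K * ‖exp (-ζ)‖) := by
    intro ζ hζ
    rw [hrem, norm_mul]
    gcongr
    exact (norm_fst_le (Z ζ - Y0)).trans (hK ζ (hsub hζ))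
  refine ⟨Real.exp R, Real.exp_pos _, u, ⟨?_, ?_⟩, ?_, ?_⟩
  · rw [sector_exp]
    have h1 : DifferentiableOn ℂ (fun ζ => (Z ζ).1) (strip A B R) := fun ζ hζ =>
      (hZR.fst ζ hζ).differentiableAt.differentiableWithinAt
    exact DifferentiableOn.add (by fun_prop) (DifferentiableOn.mul (by fun_prop) h1)
  · rw [sector_exp]
    intro ζ hζ
    exact (sigmaPVI_iff (isOpen_strip A B R) (u := u) (fun z _ => rfl)
      (fun z hz => hasDerivAt_unscaled_fst (hZR.fst z hz))
      (fun z hz => hasDerivAt_unscaled_snd (hZR.snd z hz)) hζ).2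
      (sigmaPoly_eq_zero ha hZR hbR hDR hζ)
  · refine isLittleO_iff.2 fun e he => eventually_atInfty.2 ?_
    obtain ⟨R₃, hR₃⟩ := exists_norm_exp_mul_lt (c := -1) (by simp) A B
      (η := e / (|K| + 1)) (by positivity)
    refine ⟨max R R₃, fun ζ hζ => ?_⟩
    have h1 := hremb ζ (strip_mono le_rfl le_rfl (le_max_left _ _) hζ)
    have h2 := hR₃ (max R R₃) (le_max_right _ _) ζ hζ
    rw [lt_div_iff₀ (by positivity), neg_one_mul] at h2
    refine h1.trans ?_
    rw [mul_comm]
    gcongr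
    nlinarith [le_abs_self K, norm_nonneg (exp (-ζ))]
  · refine IsBigO.of_bound K (eventually_atInfty.2 ⟨R, fun ζ hζ => (hremb ζ hζ).trans_eq ?_⟩)
    have : exp ((-1 - 2 * a) * ζ) = exp (-2 * a * ζ) * exp (-ζ) := by
      rw [← exp_add]; ring_nf
    rw [this, norm_mul]
    ring

end Algebra

end PainleveSixSigma

theorem proposition1 (ν₁ ν₃ ν₄ : ℂ) (hν₁ : 0 < ν₁.re) (A B : ℝ) (hAB : A < B) (C : ℂ) :
    ∃ ρ : ℝ, 0 < ρ ∧ ∃ u : ℂ → ℂ,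
      PainleveSixSigma.IsSolution ν₁ ν₃ ν₄ A B ρ u ∧
      PainleveSixSigma.HasExpansion ν₁ ν₃ ν₄ C A B u ∧
      PainleveSixSigma.remainder ν₁ ν₃ ν₄ C u
        =O[PainleveSixSigma.atInfty A B] (fun ζ => Complex.exp ((-1 - 2 * ν₁) * ζ)) ∧
      ∀ (ρ' : ℝ) (v : ℂ → ℂ), 0 < ρ' →
        PainleveSixSigma.IsSolution ν₁ ν₃ ν₄ A B ρ' v →
        PainleveSixSigma.HasExpansion ν₁ ν₃ ν₄ C A B v →
        Set.EqOn v u (PainleveSixSigma.sector A B (max ρ ρ')) := by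
  obtain ⟨ρ, hρ, u, hu, hue, hO⟩ :=
    PainleveSixSigma.exists_solution (c := ν₃) (d := ν₄) hν₁ A B C
  exact ⟨ρ, hρ, u, hu, hue, hO, fun ρ' v hρ' hv hve =>
    PainleveSixSigma.eqOn_of_hasExpansion hν₁ hAB hρ hρ' hu hv hue hve⟩
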